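/- A finite automaton is a tuple $\mathcal S=(X,T,X_0,\to,\Sigma,\ell)$ with finite sets $X$ (states), $T$ (events), $\Sigma$ (labels), initial states $X_0\subset X$, a transition relation $\to\subset X\times T\times X$, and a labeling function $\ell:T\to\Sigma\cup\{\epsilon\}$, which is extended to finite and infinite event sequences by concatenation; an event is observable if its label is not $\epsilon$. For $\sigma\in\Sigma^*$ let $\mathcal M(\mathcal S,\sigma)$ be the set of states $x$ such that $x_0\xrightarrow{s}x$ for some $x_0\in X_0$ and some $s\in T^*$ with $\ell(s)=\sigma$. Let $\mathcal L^\omega(\mathcal S)$ be the set of infinite label sequences $\ell(t_1t_2\cdots)\in\Sigma^\omega$ of infinite event sequences for which there are states $x_0\in X_0$ and $x_1,x_2,\dots$ with $x_0\xrightarrow{t_1}x_1\xrightarrow{t_2}\cdots$. $\mathcal S$ is eventually strongly detectable (ESD) if for each $\sigma\in\mathcal L^\omega(\mathcal S)$ there is a positive integer $k_\sigma$ such that $|\mathcal M(\mathcal S,\sigma')|=1$ for every prefix $\sigma'$ of $\sigma$ with $|\sigma'|>k_\sigma$. The accessible part $\mathrm{Acc}(\mathcal S)$ is obtained by removing all states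 not reachable from $X_0$. The concurrent composition $\mathrm{CC}(\mathcal S)$ has state set $X\times X$, initial states $X_0\times X_0$, and two kinds of transitions: joint transitions $(x,y)\xrightarrow{(t,t')}(x',y')$ with $x\xrightarrow{t}x'$, $y\xrightarrow{t'}y'$ and $\ell(t)=\ell(t')\in\Sigma$, having label $\ell(t)$; and one-sided transitions $(x,y)\xrightarrow{(t,\epsilon)}(x',y)$ for $x\xrightarrow{t}x'$ with $\ell(t)=\epsilon$, respectively $(x,y)\xrightarrow{(\epsilon,t)}(x,y')$ for $y\xrightarrow{t}y'$ with $\ell(t)=\epsilon$, having label $\epsilon$. For states $j,i$ of an automaton joined by at least one transition $j\xrightarrow{t}i$, the pair $j\to i$ is a bifurcation transition if (a) some transition $j\xrightarrow{t}j'$ has $\ell(t)=\epsilon$ and $j'\ne j$, or (b) there are transitions $j\xrightarrow{t}i$ and $j\xrightarrow{t'}j'$ with $\ell(t)=\ell(t')\ne\epsilon$ and $j'\neq i$. Theorem. (i) Eventual strong detectability of finite automata can be verified in polynomial time, namely in time $O(|X|^4|T|^2)$: there are a program $P$ of a random access machine with unit costs (storage for natural numbers with indirect addressing; arithmetic by constants,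 addition and truncated subtraction) and a constant $C$ such that, for every finite automaton, given by $|X|,|T|,|\Sigma|$, the Boolean $X\times T\times X$ table of $\to$, the list of the labels of the events and the Boolean table of $X_0$, for any enumerations of $X$, $T$, $\Sigma$, the program halts after at most $C(|X|^4|T|^2+1)$ steps and outputs whether the automaton is eventually strongly detectable. (ii) A finite automaton $\mathcal S$ is not eventually strongly detectable if and only if at least one of the following holds: (1) some state $(x,y)$ of $\mathrm{Acc}(\mathrm{CC}(\mathcal S))$ with $x\ne y$ lies on a cycle of $\mathrm{Acc}(\mathrm{CC}(\mathcal S))$ with nonempty label sequence; (2) some state of $\mathrm{Acc}(\mathcal S)$ lies both on a cycle of $\mathrm{Acc}(\mathcal S)$ that contains an observable transition and on a cycle of $\mathrm{Acc}(\mathcal S)$ that contains a bifurcation transition. -/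

import Mathlib

universe u v w

/-- A labeled state-transition system with state set `X`, event set `T` and label set `A`.
The value `none` of the labeling function is the empty word; an event with this label is
unobservable. A finite automaton is such a system with `X`, `T`, `A` finite. -/
structure LSTS (X : Type u) (T : Type v) (A : Type w) where
  /-- the initial states -/
  init : Set X
  /-- the transition relation -/
  trans : X → T → X → Prop
  /-- the labeling function -/
  label : T → Option A

namespace LSTS

variable {X : Type u} {T : Type v} {A : Type w}

/-- The labeling function extended to finite event sequences. -/
def word (S : LSTS X T A) (s : List T) : List A :=
  s.filterMap S.label

/-- `S.Path x s y`: the finite (possibly empty) event sequence `s` leads from `x` to `y`. -/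
inductive Path (S : LSTS X T A) : X → List T → X → Prop
  | nil (x : X) : Path S x [] x
  | cons {x y z : X} {t : T} {s : List T} :
      S.trans x t y → Path S y s z → Path S x (t :: s) z

/-- A state is reachable if it is initial or some event sequence leads to it from an
initial state. -/
def Reachable (S : LSTS X T A) (x : X) : Prop :=
  ∃ x₀ ∈ S.init, ∃ s : List T, S.Path x₀ s x

/-- The accessible part: all non-reachable states are removed. -/
def acc (S : LSTS X T A) : LSTS {x : X // S.Reachable x} T A where
  init := {x | x.1 ∈ S.init}
  trans x t y := S.trans x.1 t y.1
  label := S.label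

/-- The set of states the system can be in after the label sequence `σ` has been observed. -/
def current (S : LSTS X T A) (σ : List A) : Set X :=
  {x | ∃ x₀ ∈ S.init, ∃ s : List T, S.word s = σ ∧ S.Path x₀ s x}

/-- The prefix of length `k` of an infinite sequence. -/
def pre {B : Type*} (σ : ℕ → B) (k : ℕ) : List B :=
  (List.range k).map σ

/-- The infinite event sequence `t` is generated by `S`. -/
def Generated (S : LSTS X T A) (t : ℕ → T) : Prop :=
  ∃ x : ℕ → X, x 0 ∈ S.init ∧ ∀ i, S.trans (x i) (t i) (x (i + 1))

/-- The label sequence of the infinite event sequence `t` is the infinite sequence `σ`: the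
finite prefixes of `t` carry initial segments of `σ`, and all of `σ` is exhausted. -/
def OmegaWord (S : LSTS X T A) (t : ℕ → T) (σ : ℕ → A) : Prop :=
  (∀ n, ∃ k, S.word (pre t n) = pre σ k) ∧ (∀ k, ∃ n, S.word (pre t n) = pre σ k)

/-- The ω-language generated by `S`. -/
def omegaLanguage (S : LSTS X T A) : Set (ℕ → A) :=
  {σ | ∃ t : ℕ → T, S.Generated t ∧ S.OmegaWord t σ}

/-- Eventual strong detectability. -/
def EventuallyStronglyDetectable (S : LSTS X T A) : Prop :=
  ∀ σ ∈ S.omegaLanguage, ∃ k : ℕ, 0 < k ∧ ∀ j : ℕ, k < j → (S.current (pre σ j)).encard = 1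

/-! ### Concurrent composition -/

/-- The events of the concurrent composition: pairs of observable events with the same label,
and single unobservable events on the left or on the right (`none` is the empty word). -/
def ccEvents (S : LSTS X T A) : Set (Option T × Option T) :=
  {e | (∃ t t' : T, e = (some t, some t') ∧ S.label t = S.label t' ∧ S.label t ≠ none) ∨
    (∃ t : T, e = (some t, none) ∧ S.label t = none) ∨
    (∃ t : T, e = (none, some t) ∧ S.label t = none)}

/-- One component of a move of the concurrent composition: either the component performs an
event, or it stays where it is. -/
def componentMove (S : LSTS X T A) (x : X) : Option T → X → Prop
  | some t, y => S.trans x t y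
  | none, y => x = y

/-- The concurrent composition. The label of an event is the label of its left component,
which is also that of its right component. -/
def cc (S : LSTS X T A) : LSTS (X × X) S.ccEvents A where
  init := S.init ×ˢ S.init
  trans p e q := S.componentMove p.1 e.1.1 q.1 ∧ S.componentMove p.2 e.1.2 q.2
  label e := e.1.1.bind S.label

/-! ### Bifurcation automaton -/

/-- The two events of a bifurcation automaton. -/
inductive BifurEvent
  | fair
  | bifurcation

/-- No unobservable transition leads from `j` to a different state, and no observable
transition from `j` to `i` has an equally labeled transition from `j` to a state other
than `i`. -/
def NoBifurcation (S : LSTS X T A) (j i : X) : Prop :=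
  (¬ ∃ (t : T) (j' : X), S.trans j t j' ∧ S.label t = none ∧ j' ≠ j) ∧
  ∀ t : T, S.trans j t i → S.label t ≠ none →
    ¬ ∃ (t' : T) (j' : X), S.trans j t' j' ∧ S.label t' = S.label t ∧ j' ≠ i

/-- The bifurcation automaton of `S`. -/
def bifur (S : LSTS X T A) : LSTS X BifurEvent BifurEvent where
  init := S.init
  trans j e i := (∃ t : T, S.trans j t i) ∧
    match e with
    | BifurEvent.fair => S.NoBifurcation j i
    | BifurEvent.bifurcation => ¬ S.NoBifurcation j i
  label := some

/-- The states that belong to a cycle with nonempty label sequence, i.e. to a cycle that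
contains an observable transition. -/
def onObservableCycle (S : LSTS X T A) : Set X :=
  {x | ∃ s : List T, S.Path x s x ∧ S.word s ≠ []}

/-- The states that belong to a cycle of the bifurcation automaton that contains a bifurcation
transition. -/
def onBifurcationCycle (S : LSTS X T A) : Set X :=
  {x | ∃ s : List BifurEvent, S.bifur.Path x s x ∧ BifurEvent.bifurcation ∈ s}

end LSTS

/-! ### Random access machine with unit costs -/

namespace RAM

/-- A configuration of the memory: registers, and arrays with unboundedly many cells. All
of them hold natural numbers. -/
structure Store where
  /-- contents of the registers -/
  reg : ℕ → ℕ
  /-- `arr a i` is the content of cell `i` of array `a` -/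
  arr : ℕ → ℕ → ℕ

/-- Programs over registers `R` and arrays `A`. A program mentions finitely many registers and
arrays; array cells are addressed indirectly through registers. The arithmetic consists of
constants, addition and (truncated) subtraction only. -/
inductive Program
  /-- do nothing -/
  | skip
  /-- `R i := c` -/
  | const (i c : ℕ)
  /-- `R i := R j + R k` -/
  | add (i j k : ℕ)
  /-- `R i := R j - R k` -/
  | sub (i j k : ℕ)
  /-- `R i := A a [R j]` -/
  | load (i a j : ℕ)
  /-- `A a [R i] := R j` -/
  | store (a i j : ℕ)
  /-- `p; q` -/
  | seq (p q : Program)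
  /-- `if R i > 0 then p else q` -/
  | branch (i : ℕ) (p q : Program)
  /-- `while R i > 0 do p` -/
  | loop (i : ℕ) (p : Program)

/-- Write `c` to register `i`. -/
def Store.setReg (s : Store) (i c : ℕ) : Store :=
  { s with reg := Function.update s.reg i c }

/-- Write `c` to cell `i` of array `a`. -/
def Store.setArr (s : Store) (a i c : ℕ) : Store :=
  { s with arr := Function.update s.arr a (Function.update (s.arr a) i c) }

/-- `Exec p s n s'`: program `p`, started on `s`, halts on `s'` after exactly `n` steps. Each
elementary instruction and each test of a register takes one step. -/
inductive Exec : Program → Store → ℕ → Store → Prop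
  | skip (s : Store) : Exec .skip s 1 s
  | const (s : Store) (i c : ℕ) : Exec (.const i c) s 1 (s.setReg i c)
  | add (s : Store) (i j k : ℕ) : Exec (.add i j k) s 1 (s.setReg i (s.reg j + s.reg k))
  | sub (s : Store) (i j k : ℕ) : Exec (.sub i j k) s 1 (s.setReg i (s.reg j - s.reg k))
  | load (s : Store) (i a j : ℕ) : Exec (.load i a j) s 1 (s.setReg i (s.arr a (s.reg j)))
  | store (s : Store) (a i j : ℕ) :
      Exec (.store a i j) s 1 (s.setArr a (s.reg i) (s.reg j))
  | seq {p q : Program} {s₁ s₂ s₃ : Store} {m n : ℕ} :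
      Exec p s₁ m s₂ → Exec q s₂ n s₃ → Exec (.seq p q) s₁ (m + n) s₃
  | branch_pos {i : ℕ} {p q : Program} {s s' : Store} {n : ℕ} :
      0 < s.reg i → Exec p s n s' → Exec (.branch i p q) s (n + 1) s'
  | branch_zero {i : ℕ} {p q : Program} {s s' : Store} {n : ℕ} :
      s.reg i = 0 → Exec q s n s' → Exec (.branch i p q) s (n + 1) s'
  | loop_pos {i : ℕ} {p : Program} {s₁ s₂ s₃ : Store} {m n : ℕ} :
      0 < s₁.reg i → Exec p s₁ m s₂ → Exec (.loop i p) s₂ n s₃ →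
        Exec (.loop i p) s₁ (m + n + 1) s₃
  | loop_zero {i : ℕ} {p : Program} {s : Store} :
      s.reg i = 0 → Exec (.loop i p) s 1 s

end RAM

open Classical in
/-- The input that presents a finite automaton with `n` states, `m` events and `k` labels,
enumerated by `eX`, `eT`, `eA`. Registers 0, 1, 2 hold `n`, `m`, `k`. Array 0 is the `n × m × n`
Boolean table of the transition relation, array 1 lists the labels of the events (0 for the
empty word, `c + 1` for label number `c`), and array 2 is the Boolean table of the initial
states. All other registers and cells are 0. -/
noncomputable def LSTS.input {X : Type u} {T : Type v} {A : Type w} (S : LSTS X T A)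
    {n m k : ℕ} (eX : X ≃ Fin n) (eT : T ≃ Fin m) (eA : A ≃ Fin k) : RAM.Store where
  reg
    | 0 => n
    | 1 => m
    | 2 => k
    | _ => 0
  arr
    | 0 => fun c =>
        if ∃ x t y, c = ((eX x : ℕ) * m + (eT t : ℕ)) * n + (eX y : ℕ) ∧ S.trans x t y
        then 1 else 0
    | 1 => fun c =>
        if h : c < m then
          match S.label (eT.symm ⟨c, h⟩) with
          | none => 0
          | some a => (eA a : ℕ) + 1
        else 0
    | 2 => fun c => if ∃ x, c = (eX x : ℕ) ∧ x ∈ S.init then 1 else 0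
    | _ => fun _ => 0

namespace LSTS

variable {X : Type u} {T : Type v} {A : Type w}

/-! ### Paths and words -/

/-! Cycles refute detectability. Repeat forever a cycle with nonempty label sequence; it suffices
that every round contains an ambiguous moment (`not_eventuallyStronglyDetectable_of_cycle`). For
(1), the two projections of the cycle are runs with equal labels that end each round in different
states. For (2), the two cycles are joined at their common state, and in each round the bifurcation
offers a second state under the same observation.

Conversely, take a run that witnesses failure and, at an ambiguous moment, a rival path with the
same labels and another final state. Look at the pair backwards from its end. As long as the
components stay apart, every label is a `SplitStep`; where they last coincide, the run has a
bifurcation. If there is no infinite sequence of such steps (`StaysSplit` fails), no sequence has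
length `|X|²` (`exists_closed_of_chain`), so every late ambiguity has a bifurcation within its last
`|X|²` labels (`exists_bifurcation_or_chain`). Hence the run has infinitely many bifurcations,
infinitely many of them at one state, and two sufficiently distant visits give `Rebranches`. Since
`StaysSplit` implies (1) and `Rebranches` implies (2), both pairs of conditions are equivalent to
failure. The implication from (1) to `StaysSplit` alone may be false, because a cycle as in (1) may
cross the diagonal.

The algorithm tests `StaysSplit` and `Rebranches`. A naive cubic transitive closure on `|X|²` pairs
would exceed the time bound. Instead, `StaysSplit` is decided by peeling off pairs without remaining
successors. Peeling and reachability both compute a least set closed under a counting rule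
(`run_closure`), with `|X|⁴` operations on an adjacency matrix. `Rebranches` needs only the closure
on single states. Filling the matrices by enumeration of four states and two events costs
`|X|⁴|T|²`.

The program is written in a language whose loops are bounded by `n`, `m` and `n²`, and is translated
to the machine (`Code.exec_compile`). The exponents of its running time can be read off from the
nesting of the loops (`Code.time_le`). Tables of multiples replace multiplication. -/

theorem word_append (S : LSTS X T A) (s s' : List T) :
    S.word (s ++ s') = S.word s ++ S.word s' :=
  List.filterMap_append

theorem word_cons_none {S : LSTS X T A} {t : T} (s : List T) (h : S.label t = none) :
    S.word (t :: s) = S.word s :=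
  List.filterMap_cons_none h

theorem word_cons_some {S : LSTS X T A} {t : T} {a : A} (s : List T) (h : S.label t = some a) :
    S.word (t :: s) = a :: S.word s :=
  List.filterMap_cons_some h

theorem Path.append {S : LSTS X T A} {x y z : X} {s s' : List T} (h : S.Path x s y)
    (h' : S.Path y s' z) : S.Path x (s ++ s') z := by
  induction h with
  | nil => exact h'
  | cons ht _ ih => exact .cons ht (ih h')

theorem Path.single {S : LSTS X T A} {x y : X} {t : T} (h : S.trans x t y) : S.Path x [t] y :=
  .cons h (.nil _)

theorem Path.replicate {S : LSTS X T A} {x : X} {s : List T} (h : S.Path x s x) (q : ℕ) :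
    S.Path x (List.replicate q s).flatten x := by
  induction q with
  | zero => exact .nil _
  | succ q ih => simpa [List.replicate_succ] using h.append ih

theorem Reachable.append {S : LSTS X T A} {x y : X} {s : List T} (h : S.Reachable x)
    (hs : S.Path x s y) : S.Reachable y := by
  obtain ⟨x₀, h₀, s₀, hp⟩ := h
  exact ⟨x₀, h₀, _, hp.append hs⟩

theorem Reachable.step {S : LSTS X T A} {x y : X} {t : T} (h : S.Reachable x)
    (ht : S.trans x t y) : S.Reachable y :=
  h.append (.single ht)

theorem word_replicate (S : LSTS X T A) (s : List T) (q : ℕ) :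
    S.word (List.replicate q s).flatten = (List.replicate q (S.word s)).flatten := by
  induction q with
  | zero => rfl
  | succ q ih => simp [List.replicate_succ, word_append, ih]

theorem word_eq_nil_iff {S : LSTS X T A} {s : List T} :
    S.word s = [] ↔ ∀ t ∈ s, S.label t = none :=
  List.filterMap_eq_nil_iff

/-- One step by an arbitrary event. -/
def Step (S : LSTS X T A) (x y : X) : Prop :=
  ∃ t, S.trans x t y

/-- One step by an unobservable event. -/
def EpsStep (S : LSTS X T A) (x y : X) : Prop :=
  ∃ t, S.trans x t y ∧ S.label t = none

theorem reflTransGen_step_iff {S : LSTS X T A} {x y : X} :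
    Relation.ReflTransGen S.Step x y ↔ ∃ s, S.Path x s y := by
  constructor
  · intro h
    induction h with
    | refl => exact ⟨_, .nil _⟩
    | tail _ h ih =>
      obtain ⟨s, hs⟩ := ih
      obtain ⟨t, ht⟩ := h
      exact ⟨_, hs.append (.single ht)⟩
  · rintro ⟨s, hs⟩
    induction hs with
    | nil => exact .refl
    | cons ht _ ih => exact .head ⟨_, ht⟩ ih

theorem exists_path_of_reflTransGen_epsStep {S : LSTS X T A} {x y : X}
    (h : Relation.ReflTransGen S.EpsStep x y) : ∃ s, S.Path x s y ∧ S.word s = [] := by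
  induction h with
  | refl => exact ⟨_, .nil _, rfl⟩
  | tail _ h ih =>
    obtain ⟨s, hs, hw⟩ := ih
    obtain ⟨t, ht, hl⟩ := h
    exact ⟨_, hs.append (.single ht), by rw [word_append, hw, word_cons_none _ hl]; rfl⟩

/-! ### Prefixes of infinite sequences -/

theorem pre_zero {B : Type*} (σ : ℕ → B) : pre σ 0 = [] := rfl

theorem pre_succ {B : Type*} (σ : ℕ → B) (n : ℕ) : pre σ (n + 1) = pre σ n ++ [σ n] := by
  simp [pre, List.range_succ]

theorem length_pre {B : Type*} (σ : ℕ → B) (n : ℕ) : (pre σ n).length = n := by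
  simp [pre]

theorem pre_add {B : Type*} (σ : ℕ → B) (n r : ℕ) :
    pre σ (n + r) = pre σ n ++ (List.range' n r).map σ := by
  simp only [pre, List.range_eq_range', ← List.map_append]
  congr 1
  simpa using (List.range'_append (s := 0) (m := n) (n := r) (step := 1)).symm

theorem pre_prefix {B : Type*} (σ : ℕ → B) {n k : ℕ} (h : n ≤ k) : pre σ n <+: pre σ k := by
  obtain ⟨r, rfl⟩ := Nat.exists_eq_add_of_le h
  exact ⟨_, (pre_add σ n r).symm⟩

theorem word_pre_prefix (S : LSTS X T A) (t : ℕ → T) {n k : ℕ} (h : n ≤ k) :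
    S.word (pre t n) <+: S.word (pre t k) :=
  (pre_prefix t h).filterMap _

theorem eq_pre_of_prefix {B : Type*} {σ : ℕ → B} {l : List B} {k : ℕ} (h : l <+: pre σ k) :
    l = pre σ l.length := by
  have hk : l.length ≤ k := by simpa [length_pre] using h.length_le
  exact (List.prefix_of_prefix_length_le h (pre_prefix σ hk) (by rw [length_pre])).eq_of_length
    (by rw [length_pre])

/-- An infinite event sequence with infinitely many observable events has a label sequence. -/
theorem exists_omegaWord (S : LSTS X T A) (t : ℕ → T)
    (h : ∀ k, ∃ n, k ≤ (S.word (pre t n)).length) : ∃ σ, S.OmegaWord t σ := by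
  choose N hN using h
  -- Letter `k` is read off from some prefix whose word is longer than `k`. The words of the
  -- prefixes are nested, so the choice of the prefix is immaterial.
  refine ⟨fun k => (S.word (pre t (N (k + 1))))[k]'(hN (k + 1)), ?_⟩
  set σ : ℕ → A := fun k => (S.word (pre t (N (k + 1))))[k]'(hN (k + 1))
  have key : ∀ n, S.word (pre t n) = pre σ (S.word (pre t n)).length := by
    intro n
    refine List.ext_getElem (by rw [length_pre]) fun i h₁ h₂ => ?_
    simp only [pre, List.getElem_map, List.getElem_range, σ]
    rcases le_total n (N (i + 1)) with h | h
    · exact ((S.word_pre_prefix t h).getElem h₁)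
    · exact ((S.word_pre_prefix t h).getElem _).symm
  refine ⟨fun n => ⟨_, key n⟩, fun k => ?_⟩
  have h₁ : pre σ k <+: S.word (pre t (N k)) := by
    rw [key (N k)]
    exact pre_prefix σ (hN k)
  -- One event adds at most one letter, so every length is attained.
  have : ∃ n, (S.word (pre t n)).length = k := by
    have hk := hN k
    generalize N k = n at hk
    clear h₁
    induction n with
    | zero => exact ⟨0, (Nat.le_zero.1 hk).symm⟩
    | succ n ih =>
      rw [pre_succ, word_append, List.length_append] at hk
      have h1 : (S.word [t n]).length ≤ 1 := List.length_filterMap_le _ _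
      rcases Nat.lt_or_ge (S.word (pre t n)).length k with hlt | hge
      · exact ⟨n + 1, by rw [pre_succ, word_append, List.length_append]; omega⟩
      · exact ih hge
  obtain ⟨n, hn⟩ := this
  exact ⟨n, by rw [key n, hn]⟩

/-- A finite path followed by a nonempty cycle, repeated forever, is generated. -/
theorem exists_generated_of_cycle {S : LSTS X T A} {x₀ x : X} {s c : List T} (h₀ : x₀ ∈ S.init)
    (hs : S.Path x₀ s x) (hc : S.Path x c x) (hne : c ≠ []) :
    ∃ t, S.Generated t ∧ ∀ q, ∃ n, pre t n = s ++ (List.replicate q c).flatten := by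
  -- A configuration is a state with a remaining path to `x`; once that path is used up, `c` starts
  -- afresh. Iterating this avoids indices modulo the length of `c`.
  have step : ∀ p : {p : X × List T // S.Path p.1 p.2 x},
      ∃ (t : T) (p' : {p : X × List T // S.Path p.1 p.2 x}), S.trans p.1.1 t p'.1.1 ∧
        (p.1.2 = t :: p'.1.2 ∨ p.1.2 = [] ∧ c = t :: p'.1.2) := by
    rintro ⟨⟨y, l⟩, hp⟩
    cases hp with
    | nil =>
      cases hc with
      | nil => exact absurd rfl hne
      | cons ht hr => exact ⟨_, ⟨(_, _), hr⟩, ht, .inr ⟨rfl, rfl⟩⟩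
    | cons ht hr => exact ⟨_, ⟨(_, _), hr⟩, ht, .inl rfl⟩
  choose t p' htr hp' using step
  let conf : ℕ → {p : X × List T // S.Path p.1 p.2 x} := fun i => p'^[i] ⟨(x₀, s), hs⟩
  have conf_succ : ∀ i, conf (i + 1) = p' (conf i) := fun i => Function.iterate_succ_apply' ..
  have walk : ∀ (l : List T) (i : ℕ), (conf i).1.2 = l →
      (conf (i + l.length)).1.2 = [] ∧
        pre (fun i => t (conf i)) (i + l.length) = pre (fun i => t (conf i)) i ++ l := by
    intro l
    induction l with
    | nil => intro i hi; simpa using hi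
    | cons a l ih =>
      intro i hi
      rcases hp' (conf i) with h | h
      · rw [hi, List.cons.injEq] at h
        obtain ⟨h1, h2⟩ := ih (i + 1) (by rw [conf_succ]; exact h.2.symm)
        rw [List.length_cons, ← add_assoc, add_right_comm]
        exact ⟨h1, by rw [h2, pre_succ, h.1]; simp⟩
      · rw [hi] at h
        simp at h
  have cyc : ∀ i, (conf i).1.2 = [] → (conf (i + c.length)).1.2 = [] ∧
        pre (fun i => t (conf i)) (i + c.length) = pre (fun i => t (conf i)) i ++ c := by
    intro i hi
    rcases hp' (conf i) with h | h
    · rw [hi] at h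
      simp at h
    · have h' := h.2
      obtain ⟨h1, h2⟩ := walk _ (i + 1) (by rw [conf_succ])
      rw [h', List.length_cons, add_comm _ 1, ← add_assoc]
      exact ⟨h1, by rw [h2, pre_succ]; simp⟩
  refine ⟨fun i => t (conf i), ⟨fun i => (conf i).1.1, h₀, fun i => ?_⟩, fun q => ?_⟩
  · simpa only [conf_succ] using htr (conf i)
  · have : ∃ n, (conf n).1.2 = [] ∧
        pre (fun i => t (conf i)) n = s ++ (List.replicate q c).flatten := by
      induction q with
      | zero =>
        obtain ⟨h1, h2⟩ := walk s 0 rfl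
        exact ⟨_, h1, by simpa [pre_zero] using h2⟩
      | succ q ih =>
        obtain ⟨n, h1, h2⟩ := ih
        obtain ⟨h3, h4⟩ := cyc n h1
        exact ⟨_, h3, by rw [h4, h2, List.replicate_succ']; simp⟩
    obtain ⟨n, -, h⟩ := this
    exact ⟨n, h⟩

/-- A cycle that can be repeated such that the current state is ambiguous in every round
prevents eventual strong detectability. -/
theorem not_eventuallyStronglyDetectable_of_cycle {S : LSTS X T A} {x₀ x : X} {s c : List T}
    (h₀ : x₀ ∈ S.init) (hs : S.Path x₀ s x) (hc : S.Path x c x) (hw : S.word c ≠ [])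
    (hamb : ∀ q, ∃ w, w <+: S.word c ∧
      (S.current (S.word s ++ (List.replicate q (S.word c)).flatten ++ w)).Nontrivial) :
    ¬ S.EventuallyStronglyDetectable := by
  intro hesd
  have hne : c ≠ [] := by rintro rfl; exact hw rfl
  obtain ⟨t, hgen, ht⟩ := exists_generated_of_cycle h₀ hs hc hne
  have hlen : ∀ q, q ≤ (List.replicate q (S.word c)).flatten.length := by
    intro q
    have := List.length_pos_of_ne_nil hw
    simp only [List.length_flatten, List.map_replicate, List.sum_replicate, smul_eq_mul]
    exact Nat.le_mul_of_pos_right _ this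
  have hword : ∀ q, ∃ n,
      S.word (pre t n) = S.word s ++ (List.replicate q (S.word c)).flatten := by
    intro q
    obtain ⟨n, hn⟩ := ht q
    exact ⟨n, by rw [hn, word_append, word_replicate]⟩
  obtain ⟨σ, hσ⟩ := S.exists_omegaWord t fun k => by
    obtain ⟨n, hn⟩ := hword k
    have := hlen k
    exact ⟨n, by rw [hn, List.length_append]; omega⟩
  obtain ⟨k, -, hk⟩ := hesd σ ⟨t, hgen, hσ⟩
  -- After `k + 1` rounds more than `k` labels have been observed. The ambiguous word ends within
  -- the next copy of `c`, hence is still a prefix of `σ`.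
  obtain ⟨w, hwp, hnt⟩ := hamb (k + 1)
  obtain ⟨n, hn⟩ := hword (k + 1 + 1)
  obtain ⟨j, hj⟩ := hσ.1 n
  have hpre : S.word s ++ (List.replicate (k + 1) (S.word c)).flatten ++ w <+: pre σ j := by
    rw [← hj, hn, List.replicate_succ' (n := k + 1), List.flatten_append]
    simpa using hwp
  have h2 := hk (S.word s ++ (List.replicate (k + 1) (S.word c)).flatten ++ w).length (by
    have := hlen (k + 1)
    simp only [List.length_append]
    omega)
  rw [← eq_pre_of_prefix hpre] at h2
  exact (Set.one_lt_encard_iff_nontrivial.mpr hnt).ne' h2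

/-! ### Concurrent composition -/

theorem cc_path_fst {S : LSTS X T A} {p q : X × X} {s : List S.ccEvents} (h : S.cc.Path p s q) :
    ∃ s₁, S.Path p.1 s₁ q.1 ∧ S.word s₁ = S.cc.word s := by
  induction h with
  | nil p => exact ⟨[], .nil _, rfl⟩
  | @cons p p' q e s ht _ ih =>
    obtain ⟨s₁, h₁, hw⟩ := ih
    obtain ⟨⟨e₁, e₂⟩, he⟩ := e
    obtain ⟨hl, hr⟩ := ht
    rcases e₁ with _ | t
    · refine ⟨s₁, by rwa [show p.1 = p'.1 from hl], ?_⟩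
      rw [hw, word_cons_none]
      rfl
    · refine ⟨t :: s₁, .cons hl h₁, ?_⟩
      have : S.cc.label ⟨(some t, e₂), he⟩ = S.label t := rfl
      rcases hlab : S.label t with _ | a
      · rw [word_cons_none _ hlab, word_cons_none _ (this.trans hlab), hw]
      · rw [word_cons_some _ hlab, word_cons_some _ (this.trans hlab), hw]

theorem cc_path_snd {S : LSTS X T A} {p q : X × X} {s : List S.ccEvents} (h : S.cc.Path p s q) :
    ∃ s₂, S.Path p.2 s₂ q.2 ∧ S.word s₂ = S.cc.word s := by
  induction h with
  | nil p => exact ⟨[], .nil _, rfl⟩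
  | @cons p p' q e s ht _ ih =>
    obtain ⟨s₁, h₁, hw⟩ := ih
    obtain ⟨⟨e₁, e₂⟩, he⟩ := e
    obtain ⟨hl, hr⟩ := ht
    -- The label is defined through the left component; its agreement with the right one comes from
    -- `ccEvents`.
    have hlab : S.cc.label ⟨(e₁, e₂), he⟩ = e₂.bind S.label := by
      rcases he with ⟨t, t', h, h', -⟩ | ⟨t, h, h'⟩ | ⟨t, h, h'⟩ <;>
        · cases h
          simp [cc, h']
    rcases e₂ with _ | t
    · refine ⟨s₁, by rwa [show p.2 = p'.2 from hr], ?_⟩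
      rw [hw, word_cons_none]
      exact hlab
    · refine ⟨t :: s₁, .cons hr h₁, ?_⟩
      rcases hlab' : S.label t with _ | a
      · rw [word_cons_none _ hlab', word_cons_none _ (hlab.trans hlab'), hw]
      · rw [word_cons_some _ hlab', word_cons_some _ (hlab.trans hlab'), hw]

theorem cc_step_left {S : LSTS X T A} {x x' : X} {t : T} (ht : S.trans x t x')
    (hl : S.label t = none) (y : X) :
    ∃ e, S.cc.trans (x, y) e (x', y) ∧ S.cc.label e = none :=
  ⟨⟨(some t, none), .inr (.inl ⟨t, rfl, hl⟩)⟩, ⟨ht, rfl⟩, hl⟩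

theorem cc_step_right {S : LSTS X T A} {y y' : X} {t : T} (ht : S.trans y t y')
    (hl : S.label t = none) (x : X) :
    ∃ e, S.cc.trans (x, y) e (x, y') ∧ S.cc.label e = none :=
  ⟨⟨(none, some t), .inr (.inr ⟨t, rfl, hl⟩)⟩, ⟨rfl, ht⟩, rfl⟩

theorem cc_step_joint {S : LSTS X T A} {x x' y y' : X} {t t' : T} (ht : S.trans x t x')
    (ht' : S.trans y t' y') (hl : S.label t = S.label t') (hn : S.label t ≠ none) :
    ∃ e, S.cc.trans (x, y) e (x', y') ∧ S.cc.label e ≠ none :=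
  ⟨⟨(some t, some t'), .inl ⟨t, t', rfl, hl, hn⟩⟩, ⟨ht, ht'⟩, hn⟩

theorem cc_step_iff {S : LSTS X T A} {p q : X × X} :
    S.cc.Step p q ↔
      (∃ t t', S.trans p.1 t q.1 ∧ S.trans p.2 t' q.2 ∧ S.label t = S.label t' ∧
        S.label t ≠ none) ∨
      (∃ t, S.trans p.1 t q.1 ∧ S.label t = none ∧ p.2 = q.2) ∨
      (∃ t, S.trans p.2 t q.2 ∧ S.label t = none ∧ p.1 = q.1) := by
  obtain ⟨x, y⟩ := p
  obtain ⟨x', y'⟩ := q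
  constructor
  · rintro ⟨⟨e, he⟩, h1, h2⟩
    rcases he with ⟨t, t', rfl, hl, hn⟩ | ⟨t, rfl, hl⟩ | ⟨t, rfl, hl⟩
    · exact .inl ⟨t, t', h1, h2, hl, hn⟩
    · exact .inr (.inl ⟨t, h1, hl, h2⟩)
    · exact .inr (.inr ⟨t, h2, hl, h1⟩)
  · rintro (⟨t, t', h1, h2, hl, hn⟩ | ⟨t, h, hl, rfl⟩ | ⟨t, h, hl, rfl⟩)
    · obtain ⟨e, he, -⟩ := cc_step_joint h1 h2 hl hn
      exact ⟨e, he⟩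
    · obtain ⟨e, he, -⟩ := cc_step_left h hl y
      exact ⟨e, he⟩
    · obtain ⟨e, he, -⟩ := cc_step_right h hl x
      exact ⟨e, he⟩

theorem exists_cc_path_eps {S : LSTS X T A} {x x' y y' : X}
    (hx : Relation.ReflTransGen S.EpsStep x x') (hy : Relation.ReflTransGen S.EpsStep y y') :
    ∃ s, S.cc.Path (x, y) s (x', y') ∧ S.cc.word s = [] := by
  apply exists_path_of_reflTransGen_epsStep
  have h1 : Relation.ReflTransGen S.cc.EpsStep (x, y) (x', y) := by
    induction hx with
    | refl => exact .refl
    | tail _ h ih =>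
      obtain ⟨t, ht, hl⟩ := h
      exact ih.tail (cc_step_left ht hl y)
  refine h1.trans ?_
  induction hy with
  | refl => exact .refl
  | tail _ h ih =>
    obtain ⟨t, ht, hl⟩ := h
    exact ih.tail (cc_step_right ht hl x')

/-- Reachability in the concurrent composition, restricted to the diagonal. -/
theorem cc_reachable_diag {S : LSTS X T A} {x : X} :
    S.cc.Reachable (x, x) ↔ S.Reachable x := by
  constructor
  · rintro ⟨p, hp, s, hs⟩
    obtain ⟨s₁, h, -⟩ := cc_path_fst hs
    exact ⟨p.1, hp.1, s₁, h⟩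
  · rintro ⟨x₀, h₀, s, hs⟩
    refine (show S.cc.Reachable (x₀, x₀) from ⟨_, ⟨h₀, h₀⟩, [], .nil _⟩).append
      (reflTransGen_step_iff.1 ?_).choose_spec
    clear h₀
    induction hs with
    | nil => exact .refl
    | @cons a b _ t _ ht _ ih =>
      refine Relation.ReflTransGen.trans ?_ ih
      -- Both components follow the same path; an unobservable event is performed first on the left,
      -- then on the right.
      by_cases hl : S.label t = none
      · obtain ⟨e, he, -⟩ := cc_step_left ht hl a
        obtain ⟨e', he', -⟩ := cc_step_right ht hl b
        exact .head ⟨e, he⟩ (.single ⟨e', he'⟩)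
      · obtain ⟨e, he, -⟩ := cc_step_joint ht ht rfl hl
        exact .single ⟨e, he⟩

/-! ### Accessible part -/

theorem path_of_acc {S : LSTS X T A} {x y : {x // S.Reachable x}} {s : List T}
    (h : S.acc.Path x s y) : S.Path x.1 s y.1 := by
  induction h with
  | nil => exact .nil _
  | cons ht _ ih => exact .cons ht ih

theorem acc_path {S : LSTS X T A} {x y : X} {s : List T} (h : S.Path x s y)
    (hx : S.Reachable x) : ∃ hy, S.acc.Path ⟨x, hx⟩ s ⟨y, hy⟩ := by
  induction h with
  | nil => exact ⟨hx, .nil _⟩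
  | cons ht _ ih =>
    obtain ⟨hy, h⟩ := ih (hx.step ht)
    exact ⟨hy, .cons (S := S.acc) (x := ⟨_, hx⟩) (y := ⟨_, hx.step ht⟩) ht h⟩

theorem mem_acc_onObservableCycle {S : LSTS X T A} {x : {x // S.Reachable x}} :
    x ∈ S.acc.onObservableCycle ↔ ∃ s, S.Path x.1 s x.1 ∧ S.word s ≠ [] := by
  constructor
  · rintro ⟨s, h, hw⟩
    exact ⟨s, path_of_acc h, hw⟩
  · rintro ⟨s, h, hw⟩
    exact ⟨s, (acc_path h x.2).2, hw⟩

/-- `j → i` is a bifurcation transition. -/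
def BifurcationEdge (S : LSTS X T A) (j i : X) : Prop :=
  S.Step j i ∧ ¬ S.NoBifurcation j i

theorem not_noBifurcation_iff {S : LSTS X T A} {j i : X} :
    ¬ S.NoBifurcation j i ↔
      (∃ (t : T) (j' : X), S.trans j t j' ∧ S.label t = none ∧ j' ≠ j) ∨
      ∃ (t t' : T) (j' : X), S.trans j t i ∧ S.label t ≠ none ∧ S.trans j t' j' ∧
        S.label t' = S.label t ∧ j' ≠ i := by
  unfold NoBifurcation
  rw [Classical.not_and_iff_not_or_not, not_not]
  refine or_congr Iff.rfl ?_
  push Not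
  constructor
  · rintro ⟨t, h1, h2, t', j', h3⟩
    exact ⟨t, t', j', h1, h2, h3⟩
  · rintro ⟨t, t', j', h1, h2, h3⟩
    exact ⟨t, h1, h2, t', j', h3⟩

/-- The rival state of a bifurcation at a reachable state is itself reachable, so passing to the
accessible part loses no bifurcation. -/
theorem acc_bifurcationEdge {S : LSTS X T A} {j i : {x // S.Reachable x}} :
    S.acc.BifurcationEdge j i ↔ S.BifurcationEdge j.1 i.1 := by
  refine and_congr Iff.rfl ?_
  rw [not_noBifurcation_iff, not_noBifurcation_iff]
  refine or_congr ⟨?_, ?_⟩ ⟨?_, ?_⟩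
  · rintro ⟨t, j', h, hl, hne⟩
    exact ⟨t, j'.1, h, hl, fun h => hne (Subtype.ext h)⟩
  · rintro ⟨t, j', h, hl, hne⟩
    exact ⟨t, ⟨j', j.2.step h⟩, h, hl, fun h => hne (congrArg Subtype.val h)⟩
  · rintro ⟨t, t', j', h1, h2, h3, h4, hne⟩
    exact ⟨t, t', j'.1, h1, h2, h3, h4, fun h => hne (Subtype.ext h)⟩
  · rintro ⟨t, t', j', h1, h2, h3, h4, hne⟩
    exact ⟨t, t', ⟨j', j.2.step h3⟩, h1, h2, h3, h4, fun h => hne (congrArg Subtype.val h)⟩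

theorem reflTransGen_of_bifur_path {S : LSTS X T A} {x y : X} {s : List BifurEvent}
    (h : S.bifur.Path x s y) : Relation.ReflTransGen S.Step x y := by
  induction h with
  | nil => exact .refl
  | cons ht _ ih => exact .head ht.1 ih

theorem exists_bifur_path {S : LSTS X T A} {x y : X} (h : Relation.ReflTransGen S.Step x y) :
    ∃ s, S.bifur.Path x s y := by
  rw [← reflTransGen_step_iff]
  refine Relation.ReflTransGen.mono (fun a b hab => ?_) _ _ h
  by_cases hb : S.NoBifurcation a b
  · exact ⟨.fair, hab, hb⟩
  · exact ⟨.bifurcation, hab, hb⟩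

/-- The bifurcation automaton only classifies the edges of `S`, so its cycles are closed walks of
`S` and one bifurcation edge on them is all that counts. -/
theorem mem_onBifurcationCycle {S : LSTS X T A} {x : X} :
    x ∈ S.onBifurcationCycle ↔ ∃ j i, Relation.ReflTransGen S.Step x j ∧
      S.BifurcationEdge j i ∧ Relation.ReflTransGen S.Step i x := by
  constructor
  · rintro ⟨s, h, hs⟩
    suffices ∀ y s z, S.bifur.Path y s z → BifurEvent.bifurcation ∈ s →
        ∃ j i, Relation.ReflTransGen S.Step y j ∧ S.BifurcationEdge j i ∧
          Relation.ReflTransGen S.Step i z from this _ _ _ h hs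
    clear h hs
    intro y s z h hs
    induction h with
    | nil => simp at hs
    | @cons a b _ e _ ht hp ih =>
      rcases List.mem_cons.1 hs with rfl | hs
      · exact ⟨a, b, .refl, ht, reflTransGen_of_bifur_path hp⟩
      · obtain ⟨j, i, h1, h2, h3⟩ := ih hs
        exact ⟨j, i, .head ht.1 h1, h2, h3⟩
  · rintro ⟨j, i, h1, h2, h3⟩
    obtain ⟨s, hs⟩ := exists_bifur_path h1
    obtain ⟨s', hs'⟩ := exists_bifur_path h3
    refine ⟨s ++ .bifurcation :: s', hs.append (.cons (S := S.bifur) ?_ hs'), by simp⟩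
    exact h2

theorem exists_acc_reflTransGen {S : LSTS X T A} {x y : X} (hx : S.Reachable x)
    (h : Relation.ReflTransGen S.Step x y) :
    ∃ hy, Relation.ReflTransGen S.acc.Step ⟨x, hx⟩ ⟨y, hy⟩ := by
  obtain ⟨s, hs⟩ := reflTransGen_step_iff.1 h
  obtain ⟨hy, hs⟩ := acc_path hs hx
  exact ⟨hy, reflTransGen_step_iff.2 ⟨s, hs⟩⟩

theorem reflTransGen_of_acc {S : LSTS X T A} {x y : {x // S.Reachable x}}
    (h : Relation.ReflTransGen S.acc.Step x y) : Relation.ReflTransGen S.Step x.1 y.1 := by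
  obtain ⟨s, hs⟩ := reflTransGen_step_iff.1 h
  exact reflTransGen_step_iff.2 ⟨s, path_of_acc hs⟩

/-! ### The two conditions refute detectability -/

theorem not_eventuallyStronglyDetectable_of_cc {S : LSTS X T A}
    (h : ∃ p ∈ S.cc.acc.onObservableCycle, p.1.1 ≠ p.1.2) :
    ¬ S.EventuallyStronglyDetectable := by
  obtain ⟨⟨⟨x, y⟩, ⟨x₀, y₀⟩, ⟨hx₀, hy₀⟩, s, hs⟩, hc, hne⟩ := h
  obtain ⟨c, hc, hw⟩ := mem_acc_onObservableCycle.1 hc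
  obtain ⟨s₁, hs₁, e₁⟩ := cc_path_fst hs
  obtain ⟨s₂, hs₂, e₂⟩ := cc_path_snd hs
  obtain ⟨c₁, hc₁, f₁⟩ := cc_path_fst hc
  obtain ⟨c₂, hc₂, f₂⟩ := cc_path_snd hc
  refine not_eventuallyStronglyDetectable_of_cycle hx₀ hs₁ hc₁ (by rwa [f₁]) fun q =>
    ⟨[], List.nil_prefix, x, ⟨x₀, hx₀, _, ?_, hs₁.append (hc₁.replicate q)⟩, y,
      ⟨y₀, hy₀, _, ?_, hs₂.append (hc₂.replicate q)⟩, hne⟩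
  · rw [word_append, word_replicate, List.append_nil]
  · rw [word_append, word_replicate, List.append_nil, e₁, e₂, f₁, f₂]

theorem not_eventuallyStronglyDetectable_of_bifurcation {S : LSTS X T A} {x j i : X}
    {c : List T} (hx : S.Reachable x) (hc : S.Path x c x) (hw : S.word c ≠ [])
    (hj : Relation.ReflTransGen S.Step x j) (hji : S.BifurcationEdge j i)
    (hi : Relation.ReflTransGen S.Step i x) : ¬ S.EventuallyStronglyDetectable := by
  obtain ⟨x₀, h₀, s, hs⟩ := hx
  obtain ⟨a, ha⟩ := reflTransGen_step_iff.1 hj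
  obtain ⟨b, hb⟩ := reflTransGen_step_iff.1 hi
  obtain ⟨⟨t₀, ht₀⟩, hnb⟩ := hji
  rw [not_noBifurcation_iff] at hnb
  have hnil : ∀ t, S.word (c ++ (a ++ t :: b)) ≠ [] := by
    intro t h
    rw [word_append] at h
    exact hw (List.append_eq_nil_iff.1 h).1
  -- One round: the observable cycle, then the detour through the bifurcation edge.
  have hcyc : ∀ t, S.trans j t i → S.Path x (c ++ (a ++ t :: b)) x := fun t ht =>
    hc.append (ha.append (.cons ht hb))
  rcases hnb with ⟨t, j', ht, hl, hne⟩ | ⟨t, t', j', ht, hl, ht', hl', hne⟩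
  -- The ambiguity occurs at `j`, since `j'` is reached from there without a further label.
  · refine not_eventuallyStronglyDetectable_of_cycle h₀ hs (hcyc t₀ ht₀) (hnil t₀) fun q =>
      ⟨S.word (c ++ a), ?_, ?_⟩
    · rw [← List.append_assoc, word_append _ (c ++ a)]
      exact List.prefix_append ..
    · have hp := hs.append ((hcyc t₀ ht₀).replicate q) |>.append (hc.append ha)
      refine ⟨j, ⟨x₀, h₀, _, ?_, hp⟩, j', ⟨x₀, h₀, _, ?_, hp.append (.single ht)⟩, hne.symm⟩
      · simp only [word_append, word_replicate]
      · simp only [word_append, word_replicate, word_cons_none _ hl]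
        simp [word]
  -- The round must use the event `t` that has the equally labeled rival `t'`; the ambiguity occurs
  -- right after it.
  · refine not_eventuallyStronglyDetectable_of_cycle h₀ hs (hcyc t ht) (hnil t) fun q =>
      ⟨S.word (c ++ (a ++ [t])), ?_, ?_⟩
    · rw [show c ++ (a ++ t :: b) = (c ++ (a ++ [t])) ++ b by simp, word_append _ (c ++ _)]
      exact List.prefix_append ..
    · have hp := hs.append ((hcyc t ht).replicate q) |>.append (hc.append ha)
      refine ⟨i, ⟨x₀, h₀, _, ?_, hp.append (.single ht)⟩, j',
        ⟨x₀, h₀, _, ?_, hp.append (.single ht')⟩, hne.symm⟩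
      · simp only [word_append, word_replicate, List.append_assoc]
      · have : S.word [t'] = S.word [t] := by simp [word, List.filterMap_cons, hl']
        simp only [word_append, word_replicate, List.append_assoc, this]

theorem not_eventuallyStronglyDetectable_of_acc {S : LSTS X T A}
    (h : (S.acc.onObservableCycle ∩ S.acc.onBifurcationCycle).Nonempty) :
    ¬ S.EventuallyStronglyDetectable := by
  obtain ⟨x, hx, hb⟩ := h
  obtain ⟨c, hc, hw⟩ := mem_acc_onObservableCycle.1 hx
  obtain ⟨j, i, h1, h2, h3⟩ := mem_onBifurcationCycle.1 hb
  exact not_eventuallyStronglyDetectable_of_bifurcation x.2 hc hw (reflTransGen_of_acc h1)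
    (acc_bifurcationEdge.1 h2) (reflTransGen_of_acc h3)

/-! ### Conditions that can be checked by closure computations -/

/-- Unobservable events followed by the event `t`. -/
def WeakStep (S : LSTS X T A) (x : X) (t : T) (y : X) : Prop :=
  ∃ p, Relation.ReflTransGen S.EpsStep x p ∧ S.trans p t y

/-- One label is observed while the two components are in different states before and
afterwards. -/
def SplitStep (S : LSTS X T A) (p q : X × X) : Prop :=
  p.1 ≠ p.2 ∧ q.1 ≠ q.2 ∧ S.cc.Reachable p ∧
    ∃ t t', S.label t = S.label t' ∧ S.label t ≠ none ∧ S.WeakStep p.1 t q.1 ∧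
      S.WeakStep p.2 t' q.2

/-- There is an infinite sequence of steps `S.SplitStep`. -/
def StaysSplit (S : LSTS X T A) : Prop :=
  ∃ W : Set (X × X), W.Nonempty ∧ ∀ p ∈ W, ∃ q ∈ W, S.SplitStep p q

/-- A bifurcation and an observable event can be repeated alternately. -/
def Rebranches (S : LSTS X T A) : Prop :=
  ∃ j i p q t, S.Reachable j ∧ S.BifurcationEdge j i ∧ Relation.ReflTransGen S.Step i j ∧
    Relation.ReflTransGen S.Step j p ∧ S.trans p t q ∧ S.label t ≠ none ∧
    Relation.ReflTransGen S.Step q j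

theorem SplitStep.exists_path {S : LSTS X T A} {p q : X × X} (h : S.SplitStep p q) :
    ∃ s, S.cc.Path p s q ∧ S.cc.word s ≠ [] := by
  obtain ⟨x, y⟩ := p
  obtain ⟨x', y'⟩ := q
  obtain ⟨-, -, -, t, t', hl, hn, ⟨a, ha, ht⟩, b, hb, ht'⟩ := h
  obtain ⟨s, hs, -⟩ := exists_cc_path_eps ha hb
  obtain ⟨e, he, hne⟩ := cc_step_joint ht ht' hl hn
  refine ⟨_, hs.append (.single he), fun h => hne ?_⟩
  exact word_eq_nil_iff.1 h e (by simp)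

/-- Following chosen successors, some pair repeats. Each step observes a label, so the path between
the two visits has a nonempty label sequence. -/
theorem StaysSplit.exists_cycle [Finite X] {S : LSTS X T A} (h : S.StaysSplit) :
    ∃ p ∈ S.cc.acc.onObservableCycle, p.1.1 ≠ p.1.2 := by
  obtain ⟨W, ⟨p₀, h₀⟩, hW⟩ := h
  choose! f hf hstep using hW
  have hmem : ∀ i, f^[i] p₀ ∈ W := by
    intro i
    induction i with
    | zero => exact h₀
    | succ i ih => rw [Function.iterate_succ_apply']; exact hf _ ih
  have hpath : ∀ i r, ∃ s, S.cc.Path (f^[i] p₀) s (f^[i + (r + 1)] p₀) ∧ S.cc.word s ≠ [] := by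
    intro i r
    induction r with
    | zero =>
      rw [zero_add, Function.iterate_succ_apply']
      exact (hstep _ (hmem i)).exists_path
    | succ r ih =>
      obtain ⟨s, hs, hw⟩ := ih
      obtain ⟨s', hs', -⟩ := (hstep _ (hmem (i + (r + 1)))).exists_path
      rw [← add_assoc, Function.iterate_succ_apply']
      exact ⟨_, hs.append hs', by rw [word_append]; simp [hw]⟩
  obtain ⟨i, j, hij, he⟩ : ∃ i j, i < j ∧ f^[i] p₀ = f^[j] p₀ := by
    obtain ⟨i, j, hne, he⟩ := Finite.exists_ne_map_eq_of_infinite fun i => f^[i] p₀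
    rcases hne.lt_or_gt with h | h
    · exact ⟨i, j, h, he⟩
    · exact ⟨j, i, h, he.symm⟩
  obtain ⟨r, rfl⟩ := Nat.exists_eq_add_of_le hij
  obtain ⟨s, hs, hw⟩ := hpath i r
  rw [show i + (r + 1) = i.succ + r by omega, ← he] at hs
  obtain ⟨h1, -, h2, -⟩ := hstep _ (hmem i)
  exact ⟨⟨_, h2⟩, mem_acc_onObservableCycle.2 ⟨s, hs, hw⟩, h1⟩

theorem Rebranches.nonempty {S : LSTS X T A} (h : S.Rebranches) :
    (S.acc.onObservableCycle ∩ S.acc.onBifurcationCycle).Nonempty := by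
  obtain ⟨j, i, p, q, t, hj, hji, hij, hjp, ht, hl, hqj⟩ := h
  obtain ⟨a, ha⟩ := reflTransGen_step_iff.1 hjp
  obtain ⟨b, hb⟩ := reflTransGen_step_iff.1 hqj
  refine ⟨⟨j, hj⟩, mem_acc_onObservableCycle.2 ⟨_, ha.append (.cons ht hb), ?_⟩, ?_⟩
  · intro h
    exact hl (word_eq_nil_iff.1 h t (by simp))
  · have hi : S.Reachable i := hj.step hji.1.choose_spec
    obtain ⟨_, h⟩ := exists_acc_reflTransGen hi hij
    exact mem_onBifurcationCycle.2 ⟨_, ⟨i, hi⟩, .refl, acc_bifurcationEdge.2 hji, h⟩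

/-- `p` is the starting point of a sequence of `k` steps. -/
def Chain {V : Type*} (r : V → V → Prop) : ℕ → V → Prop
  | 0, _ => True
  | k + 1, p => ∃ q, r p q ∧ Chain r k q

theorem Chain.mono {V : Type*} {r : V → V → Prop} {k l : ℕ} (h : k ≤ l) {p : V}
    (hp : Chain r l p) : Chain r k p := by
  induction k generalizing l p with
  | zero => trivial
  | succ k ih =>
    obtain ⟨l, rfl⟩ := Nat.exists_eq_add_of_le' (by omega : 1 ≤ l)
    obtain ⟨q, h1, h2⟩ := hp
    exact ⟨q, h1, ih (by omega) h2⟩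

/-- The sets of starting points of chains of length `i` decrease with `i`. If a nonempty one equals
its successor, it is the wanted set; otherwise each loses an element until the one for `Nat.card V`
is empty. -/
theorem exists_closed_of_chain {V : Type*} [Finite V] {r : V → V → Prop} {p : V}
    (h : Chain r (Nat.card V) p) : ∃ W : Set V, W.Nonempty ∧ ∀ p ∈ W, ∃ q ∈ W, r p q := by
  by_contra hno
  have hcard : ∀ i, {p | Chain r i p}.ncard ≤ Nat.card V - i := by
    intro i
    induction i with
    | zero => exact Set.ncard_le_card _
    | succ i ih =>
      by_cases hemp : {p | Chain r i p} = ∅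
      · have : {p | Chain r (i + 1) p} = ∅ := Set.subset_eq_empty
          (fun p hp => Chain.mono (Nat.le_succ i) hp) hemp
        simp [this]
      · have hss : {p | Chain r (i + 1) p} ⊂ {p | Chain r i p} := by
          refine ⟨fun p hp => Chain.mono (Nat.le_succ i) hp, fun hsub => hno ?_⟩
          refine ⟨_, Set.nonempty_iff_ne_empty.2 hemp, fun p hp => ?_⟩
          obtain ⟨q, h1, h2⟩ := hsub hp
          exact ⟨q, h2, h1⟩
        have := Set.ncard_lt_ncard hss (Set.toFinite _)
        omega
  have h0 := hcard (Nat.card V)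
  rw [Nat.sub_self, Nat.le_zero, Set.ncard_eq_zero (Set.toFinite _)] at h0
  exact (h0 ▸ h : p ∈ (∅ : Set V))

/-- Unobservable moves are absorbed into the first weak steps of the chain; only the new source has
to be reachable and off the diagonal. -/
theorem chain_of_epsStep {S : LSTS X T A} {k : ℕ} {x x' y y' : X} (hne : x ≠ y)
    (hr : S.cc.Reachable (x, y)) (hx : Relation.ReflTransGen S.EpsStep x x')
    (hy : Relation.ReflTransGen S.EpsStep y y') (h : Chain S.SplitStep k (x', y')) :
    Chain S.SplitStep k (x, y) := by
  cases k with
  | zero => trivial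
  | succ k =>
    obtain ⟨q, ⟨-, h2, -, t, t', hl, hn, ⟨a, ha, ht⟩, b, hb, ht'⟩, hq⟩ := h
    exact ⟨q, ⟨hne, h2, hr, t, t', hl, hn, ⟨a, hx.trans ha, ht⟩, b, hy.trans hb, ht'⟩, hq⟩

/-- A run and a path with the same label sequence but different final states either separate
in the last `N` labels, at a bifurcation of the run, or admit a long sequence of steps
`S.SplitStep`. -/
theorem exists_bifurcation_or_chain {S : LSTS X T A} {x : ℕ → X} {t : ℕ → T}
    (hrun : ∀ i, S.trans (x i) (t i) (x (i + 1))) {N : ℕ}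
    (hN : ∀ p, ¬ Chain S.SplitStep N p) {y' : X} (l : ℕ) :
    ∀ (i r : ℕ) (s : List T) (y : X), r + s.length ≤ l → S.Path y s y' →
      S.word ((List.range' i r).map t) = S.word s → y' ≠ x (i + r) →
      S.cc.Reachable (x i, y) →
      (∃ a, S.BifurcationEdge (x a) (x (a + 1)) ∧
        (S.word (pre t (i + r))).length ≤ (S.word (pre t a)).length + N) ∨
      x i ≠ y ∧ Chain S.SplitStep (S.word s).length (x i, y) := by
  have hshort : ∀ {k p}, Chain S.SplitStep k p → k ≤ N := fun {k p} h => by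
    by_contra hlt
    exact hN p (h.mono (by omega))
  have hlast : ∀ {i r : ℕ} {s : List T}, S.word ((List.range' i r).map t) = S.word s →
      (S.word s).length ≤ N →
      (S.word (pre t (i + r))).length ≤ (S.word (pre t i)).length + N := by
    intro i r s hw hle
    rw [pre_add, word_append, hw, List.length_append]
    omega
  -- `l` bounds the number of events still to be consumed. The induction hypothesis speaks of the
  -- pair after the next move. If that pair is apart but the present one is not, the move reveals a
  -- bifurcation; if both are apart, the chain is extended backwards.
  induction l with
  | zero =>
    intro i r s y hl hp hw hne hr
    obtain ⟨rfl, hs⟩ : r = 0 ∧ s.length = 0 := by omega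
    obtain rfl := List.length_eq_zero_iff.1 hs
    cases hp
    exact .inr ⟨hne.symm, trivial⟩
  | succ l ih =>
    intro i r s y hl hp hw hne hr
    -- The run moves alone. This is needed when the rival path is exhausted and when its next event
    -- is observable.
    have left : ∀ r', r = r' + 1 → S.label (t i) = none →
        (∃ a, S.BifurcationEdge (x a) (x (a + 1)) ∧
          (S.word (pre t (i + r))).length ≤ (S.word (pre t a)).length + N) ∨
        x i ≠ y ∧ Chain S.SplitStep (S.word s).length (x i, y) := by
      rintro r' rfl hlab
      obtain ⟨e, he, -⟩ := cc_step_left (hrun i) hlab y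
      rw [List.range'_succ, List.map_cons, word_cons_none _ hlab] at hw
      rcases ih (i + 1) r' s y (by omega) hp hw (by rwa [add_right_comm, add_assoc])
        (hr.step he) with h | ⟨h1, h2⟩
      · left
        rwa [add_right_comm, add_assoc] at h
      · by_cases hxy : x i = y
        · left
          refine ⟨i, ⟨⟨_, hrun i⟩, not_noBifurcation_iff.2 (.inl
            ⟨t i, x (i + 1), hrun i, hlab, by rwa [hxy]⟩)⟩, hlast (s := s) ?_ (hshort h2)⟩
          rw [List.range'_succ, List.map_cons, word_cons_none _ hlab, hw]
        · exact .inr ⟨hxy, chain_of_epsStep hxy hr (.single ⟨_, hrun i, hlab⟩) .refl h2⟩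
    cases hp with
    | nil =>
      cases r with
      | zero => exact .inr ⟨hne.symm, trivial⟩
      | succ r => exact left r rfl (word_eq_nil_iff.1 hw _ (by simp [List.range'_succ]))
    | @cons _ y₁ _ t' s ht' hp =>
      rw [List.length_cons] at hl
      rcases hlab' : S.label t' with _ | b
      · obtain ⟨e, he, -⟩ := cc_step_right ht' hlab' (x i)
        rw [word_cons_none _ hlab'] at hw ⊢
        rcases ih i r s y₁ (by omega) hp hw hne (hr.step he) with h | ⟨h1, h2⟩
        · exact .inl h
        · by_cases hxy : x i = y
          · exact .inl ⟨i, ⟨⟨_, hrun i⟩, not_noBifurcation_iff.2 (.inl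
              ⟨t', y₁, by rwa [hxy], hlab', h1.symm⟩)⟩, hlast hw (hshort h2)⟩
          · exact .inr ⟨hxy, chain_of_epsStep hxy hr .refl (.single ⟨_, ht', hlab'⟩) h2⟩
      · cases r with
        | zero => simp [word, hlab'] at hw
        | succ r =>
          rcases hlab : S.label (t i) with _ | b'
          · exact left r rfl hlab
          · have hw' := hw
            rw [List.range'_succ, List.map_cons, word_cons_some _ hlab,
              word_cons_some _ hlab', List.cons.injEq] at hw'
            obtain ⟨rfl, hw'⟩ := hw'
            have hn : S.label (t i) ≠ none := by simp [hlab]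
            have hll : S.label (t i) = S.label t' := hlab.trans hlab'.symm
            obtain ⟨e, he, -⟩ := cc_step_joint (hrun i) ht' hll hn
            rcases ih (i + 1) r s y₁ (by omega) hp hw' (by rwa [add_right_comm, add_assoc])
              (hr.step he) with h | ⟨h1, h2⟩
            · left
              rwa [add_right_comm, add_assoc] at h
            · by_cases hxy : x i = y
              · left
                refine ⟨i, ⟨⟨_, hrun i⟩, not_noBifurcation_iff.2 (.inr
                  ⟨t i, t', y₁, hrun i, hn, by rwa [hxy], hll.symm, h1.symm⟩)⟩,
                  hlast hw ?_⟩
                -- The separating label itself has to be counted too, so the chain after it must be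
                -- strictly shorter than `N`.
                have : ¬ (S.word s).length = N := fun h => hN _ (h ▸ h2)
                have := hshort h2
                rw [word_cons_some _ hlab', List.length_cons]
                omega
              · refine .inr ⟨hxy, ?_⟩
                rw [word_cons_some _ hlab', List.length_cons]
                exact ⟨_, ⟨hxy, h1, hr, t i, t', hll, hn, ⟨_, .refl, hrun i⟩, _, .refl, ht'⟩,
                  h2⟩

/-! ### Failure of detectability yields one of the two conditions -/

theorem path_of_run {S : LSTS X T A} {x : ℕ → X} {t : ℕ → T}
    (hrun : ∀ i, S.trans (x i) (t i) (x (i + 1))) (i r : ℕ) :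
    S.Path (x i) ((List.range' i r).map t) (x (i + r)) := by
  induction r generalizing i with
  | zero => exact .nil _
  | succ r ih =>
    rw [List.range'_succ, List.map_cons, show i + (r + 1) = i + 1 + r by omega]
    exact .cons (hrun i) (ih _)

theorem reflTransGen_of_run {S : LSTS X T A} {x : ℕ → X} {t : ℕ → T}
    (hrun : ∀ i, S.trans (x i) (t i) (x (i + 1))) {i j : ℕ} (h : i ≤ j) :
    Relation.ReflTransGen S.Step (x i) (x j) := by
  obtain ⟨r, rfl⟩ := Nat.exists_eq_add_of_le h
  exact reflTransGen_step_iff.2 ⟨_, path_of_run hrun i r⟩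

theorem staysSplit_or_rebranches [Finite X] {S : LSTS X T A}
    (h : ¬ S.EventuallyStronglyDetectable) : S.StaysSplit ∨ S.Rebranches := by
  by_contra hno
  push Not at hno
  obtain ⟨hns, hnr⟩ := hno
  refine hnr ?_
  have hN : ∀ p, ¬ Chain S.SplitStep (Nat.card (X × X)) p := fun p hp =>
    hns (exists_closed_of_chain hp)
  unfold EventuallyStronglyDetectable at h
  push Not at h
  obtain ⟨σ, ⟨t, ⟨x, hx₀, hrun⟩, hσ⟩, hk⟩ := h
  have hpre : ∀ n, S.Path (x 0) (pre t n) (x n) := fun n => by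
    simpa [pre, List.range_eq_range'] using path_of_run hrun 0 n
  have hbif : ∀ K, ∃ a ≥ K, S.BifurcationEdge (x a) (x (a + 1)) := by
    intro K
    -- An ambiguity more than `Nat.card (X × X)` labels after time `K`: a bifurcation within its
    -- last `Nat.card (X × X)` labels cannot lie before `K`.
    obtain ⟨j, hj, hcur⟩ :=
      hk ((S.word (pre t K)).length + Nat.card (X × X) + 1) (by omega)
    obtain ⟨n, hn⟩ := hσ.2 j
    have hxn : x n ∈ S.current (pre σ j) := ⟨x 0, hx₀, _, hn, hpre n⟩
    obtain ⟨y', ⟨y₀, hy₀, s, hs, hp⟩, hne⟩ : ∃ y' ∈ S.current (pre σ j), y' ≠ x n := by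
      by_contra hall
      push Not at hall
      refine hcur (Set.encard_eq_one.2 ⟨x n, ?_⟩)
      ext z
      exact ⟨hall z, fun hz => hz ▸ hxn⟩
    have hlen : (S.word (pre t n)).length = j := by rw [hn, length_pre]
    rcases exists_bifurcation_or_chain hrun hN _ 0 n s y₀ le_rfl hp
      (by rw [hs, ← hn]; simp [pre, List.range_eq_range']) (by simpa using hne)
      ⟨_, ⟨hx₀, hy₀⟩, [], .nil _⟩ with ⟨a, ha, hle⟩ | ⟨-, hch⟩
    · refine ⟨a, ?_, ha⟩
      by_contra hlt
      have := (S.word_pre_prefix t (show a ≤ K by omega)).length_le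
      rw [zero_add, hlen] at hle
      omega
    · rw [hs, length_pre] at hch
      exact absurd (hch.mono (by omega)) (hN _)
  -- By finiteness of `X`, one state is the source of arbitrarily late bifurcations of the run.
  obtain ⟨j, hj⟩ : ∃ j, ∀ K, ∃ a ≥ K, S.BifurcationEdge (x a) (x (a + 1)) ∧ x a = j := by
    by_contra hall
    push Not at hall
    choose K hK using hall
    obtain ⟨M, hM⟩ := (Set.finite_range K).bddAbove
    obtain ⟨a, ha, hb⟩ := hbif M
    exact hK (x a) a ((hM ⟨_, rfl⟩).trans ha) hb rfl
  obtain ⟨a, -, ha, rfl⟩ := hj 0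
  -- By time `n` one more label than at time `a + 1` has been observed, so an observable event
  -- occurs before the later visit `b`.
  obtain ⟨n, hn⟩ := hσ.2 ((S.word (pre t (a + 1))).length + 1)
  obtain ⟨b, hb, -, hab⟩ := hj (max n (a + 1))
  have hab' : a + 1 ≤ b := le_trans (le_max_right ..) hb
  obtain ⟨p, hp1, hp2, hp3⟩ : ∃ p, a ≤ p ∧ p + 1 ≤ b ∧ S.label (t p) ≠ none := by
    by_contra hall
    push Not at hall
    obtain ⟨r, rfl⟩ := Nat.exists_eq_add_of_le hab'
    have h0 : S.word ((List.range' (a + 1) r).map t) = [] := by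
      rw [word_eq_nil_iff]
      intro e he
      obtain ⟨p, hp, rfl⟩ := List.mem_map.1 he
      rw [List.mem_range'_1] at hp
      exact hall p (by omega) (by omega)
    have h1 := (S.word_pre_prefix t ((le_max_left ..).trans hb)).length_le
    rw [hn, length_pre, pre_add t (a + 1), word_append, h0, List.append_nil] at h1
    omega
  refine ⟨x a, x (a + 1), x p, x (p + 1), t p, ⟨_, hx₀, _, hpre a⟩, ha, ?_,
    reflTransGen_of_run hrun hp1, hrun p, hp3, ?_⟩
  · exact hab ▸ reflTransGen_of_run hrun hab'
  · exact hab ▸ reflTransGen_of_run hrun hp2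

theorem not_eventuallyStronglyDetectable_iff [Finite X] {S : LSTS X T A} :
    ¬ S.EventuallyStronglyDetectable ↔ S.StaysSplit ∨ S.Rebranches :=
  ⟨staysSplit_or_rebranches, fun h => h.elim
    (fun h => not_eventuallyStronglyDetectable_of_cc h.exists_cycle)
    fun h => not_eventuallyStronglyDetectable_of_acc h.nonempty⟩

theorem not_eventuallyStronglyDetectable_iff_cycles [Finite X] {S : LSTS X T A} :
    ¬ S.EventuallyStronglyDetectable ↔
      (∃ p ∈ S.cc.acc.onObservableCycle, p.1.1 ≠ p.1.2) ∨
        (S.acc.onObservableCycle ∩ S.acc.onBifurcationCycle).Nonempty :=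
  ⟨fun h => (staysSplit_or_rebranches h).imp StaysSplit.exists_cycle Rebranches.nonempty,
    fun h => h.elim not_eventuallyStronglyDetectable_of_cc
      not_eventuallyStronglyDetectable_of_acc⟩

end LSTS

namespace RAM

/-! ### A structured language with bounded loops -/

/-- Expressions over variables, loop bounds and array cells. -/
inductive Expr
  | lit (c : ℕ)
  | var (i : ℕ)
  | bnd (b : Fin 3)
  | add (e f : Expr)
  | sub (e f : Expr)
  | get (a : ℕ) (e : Expr)

/-- Programs with bounded loops only. -/
inductive Code
  | skip
  | set (i : ℕ) (e : Expr)
  | put (a : ℕ) (e f : Expr)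
  | seq (p q : Code)
  | cond (e : Expr) (p q : Code)
  | loop (b : Fin 3) (i : ℕ) (p : Code)

/-- The value of an expression for given bounds `B`, variables `ρ` and arrays `M`. -/
def Expr.eval (B : Fin 3 → ℕ) (ρ : ℕ → ℕ) (M : ℕ → ℕ → ℕ) : Expr → ℕ
  | lit c => c
  | var i => ρ i
  | bnd b => B b
  | add e f => e.eval B ρ M + f.eval B ρ M
  | sub e f => e.eval B ρ M - f.eval B ρ M
  | get a e => M a (e.eval B ρ M)

/-- Apply `f 0`, …, `f (n - 1)` in this order. -/
def iterate (f : ℕ → Store → Store) : ℕ → Store → Store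
  | 0, s => s
  | n + 1, s => f n (iterate f n s)

/-- The effect of a program; the registers of the store are the variables. -/
def Code.run (B : Fin 3 → ℕ) : Code → Store → Store
  | skip, s => s
  | set i e, s => s.setReg i (e.eval B s.reg s.arr)
  | put a e f, s => s.setArr a (e.eval B s.reg s.arr) (f.eval B s.reg s.arr)
  | seq p q, s => q.run B (p.run B s)
  | cond e p q, s => if 0 < e.eval B s.reg s.arr then p.run B s else q.run B s
  | loop b i p, s => iterate (fun j s => p.run B (s.setReg i j)) (B b) s

/-- Variable `i` is kept in this register. -/
def varReg (i : ℕ) : ℕ := 2 * i + 3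

/-- Auxiliary register number `d`. -/
def auxReg (d : ℕ) : ℕ := 2 * d + 4

/-- Compute the value of an expression in auxiliary register `d`. -/
def Expr.compile : Expr → ℕ → Program
  | lit c, d => .const (auxReg d) c
  | var i, d => .seq (.const (auxReg d) 0) (.add (auxReg d) (varReg i) (auxReg d))
  | bnd b, d => .seq (.const (auxReg d) 0) (.add (auxReg d) b (auxReg d))
  | add e f, d => .seq (e.compile d)
      (.seq (f.compile (d + 1)) (.add (auxReg d) (auxReg d) (auxReg (d + 1))))
  | sub e f, d => .seq (e.compile d)
      (.seq (f.compile (d + 1)) (.sub (auxReg d) (auxReg d) (auxReg (d + 1))))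
  | get a e, d => .seq (e.compile d) (.load (auxReg d) a (auxReg d))

/-- The body of a compiled loop: auxiliary register `d` is the counter, the next one holds the
number of remaining rounds. -/
def loopBody (d i : ℕ) (p : Program) : Program :=
  .seq (.seq (.const (auxReg (d + 2)) 0) (.add (varReg i) (auxReg d) (auxReg (d + 2))))
    (.seq p (.seq (.const (auxReg (d + 2)) 1)
      (.seq (.add (auxReg d) (auxReg d) (auxReg (d + 2)))
        (.sub (auxReg (d + 1)) (auxReg (d + 1)) (auxReg (d + 2))))))

/-- Translation to the random access machine; only auxiliary registers from `d` on are used. -/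
def Code.compile : Code → ℕ → Program
  | skip, _ => .skip
  | set i e, d => .seq (e.compile d)
      (.seq (.const (auxReg (d + 1)) 0) (.add (varReg i) (auxReg d) (auxReg (d + 1))))
  | put a e f, d => .seq (e.compile d)
      (.seq (f.compile (d + 1)) (.store a (auxReg d) (auxReg (d + 1))))
  | seq p q, d => .seq (p.compile d) (q.compile d)
  | cond e p q, d => .seq (e.compile d) (.branch (auxReg d) (p.compile d) (q.compile d))
  | loop b i p, d => .seq (.const (auxReg d) 0)
      (.seq (Expr.compile (.bnd b) (d + 1))
        (.loop (auxReg (d + 1)) (loopBody d i (p.compile (d + 2)))))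

/-- The running time of a compiled expression. -/
def Expr.time : Expr → ℕ
  | lit _ => 1
  | var _ => 2
  | bnd _ => 2
  | add e f => e.time + (f.time + 1)
  | sub e f => e.time + (f.time + 1)
  | get _ e => e.time + 1

/-- An upper bound for the running time of a compiled program. -/
def Code.time (B : Fin 3 → ℕ) : Code → ℕ
  | skip => 1
  | set _ e => e.time + 2
  | put _ e f => e.time + (f.time + 1)
  | seq p q => p.time B + q.time B
  | cond e p q => e.time + (p.time B + q.time B + 1)
  | loop b _ p => B b * (p.time B + 6) + 4

/-- The store `s` of the machine represents the store `r` of the structured language. -/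
structure Represents (B : Fin 3 → ℕ) (s r : Store) : Prop where
  arr : s.arr = r.arr
  var : ∀ i, s.reg (varReg i) = r.reg i
  bnd : ∀ b : Fin 3, s.reg b = B b

/-! ### Correctness of the translation -/

@[simp] theorem Store.setReg_arr (s : Store) (i c : ℕ) : (s.setReg i c).arr = s.arr := rfl

@[simp] theorem Store.setReg_reg (s : Store) (i c j : ℕ) :
    (s.setReg i c).reg j = if j = i then c else s.reg j := by
  simp [Store.setReg, Function.update_apply]

@[simp] theorem Store.setArr_reg (s : Store) (a i c : ℕ) : (s.setArr a i c).reg = s.reg := rfl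

theorem Store.setArr_arr (s : Store) (a i c : ℕ) :
    (s.setArr a i c).arr = Function.update s.arr a (Function.update (s.arr a) i c) := rfl

theorem auxReg_inj {d e : ℕ} : auxReg d = auxReg e ↔ d = e := by unfold auxReg; omega

theorem varReg_inj {d e : ℕ} : varReg d = varReg e ↔ d = e := by unfold varReg; omega

theorem varReg_ne_auxReg {d e : ℕ} : varReg d ≠ auxReg e := by unfold varReg auxReg; omega

theorem bnd_ne_auxReg {b : Fin 3} {e : ℕ} : (b : ℕ) ≠ auxReg e := by
  unfold auxReg; have := b.2; omega

theorem bnd_ne_varReg {b : Fin 3} {e : ℕ} : (b : ℕ) ≠ varReg e := by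
  unfold varReg; have := b.2; omega

theorem Represents.setAux {B : Fin 3 → ℕ} {s r : Store} (h : Represents B s r) (d c : ℕ) :
    Represents B (s.setReg (auxReg d) c) r where
  arr := h.arr
  var i := by rw [Store.setReg_reg, if_neg varReg_ne_auxReg, h.var]
  bnd b := by rw [Store.setReg_reg, if_neg bnd_ne_auxReg, h.bnd]

theorem Represents.setVar {B : Fin 3 → ℕ} {s r : Store} (h : Represents B s r) (i c : ℕ) :
    Represents B (s.setReg (varReg i) c) (r.setReg i c) where
  arr := h.arr
  var j := by simp only [Store.setReg_reg, varReg_inj, h.var]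
  bnd b := by rw [Store.setReg_reg, if_neg bnd_ne_varReg, h.bnd]

theorem Represents.setArr {B : Fin 3 → ℕ} {s r : Store} (h : Represents B s r) (a i c : ℕ) :
    Represents B (s.setArr a i c) (r.setArr a i c) where
  arr := by rw [Store.setArr_arr, Store.setArr_arr, h.arr]
  var j := h.var j
  bnd b := h.bnd b

/-- Values of subexpressions that are still needed lie in auxiliary registers below `d`; their
preservation is therefore part of the induction. -/
theorem Expr.exec_compile {B : Fin 3 → ℕ} (e : Expr) {s r : Store} (h : Represents B s r)
    (d : ℕ) : ∃ s', Exec (e.compile d) s e.time s' ∧ Represents B s' r ∧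
      s'.reg (auxReg d) = e.eval B r.reg r.arr ∧ ∀ k < d, s'.reg (auxReg k) = s.reg (auxReg k) := by
  induction e generalizing s d with
  | lit c =>
    refine ⟨_, .const .., h.setAux d c, by simp [eval], fun k hk => ?_⟩
    simp [auxReg_inj, hk.ne]
  | var i =>
    refine ⟨_, .seq (.const ..) (.add ..), (h.setAux d 0).setAux _ _, ?_, fun k hk => ?_⟩
    · simp [eval, varReg_ne_auxReg, h.var]
    · simp [auxReg_inj, hk.ne]
  | bnd b =>
    refine ⟨_, .seq (.const ..) (.add ..), (h.setAux d 0).setAux _ _, ?_, fun k hk => ?_⟩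
    · simp [eval, bnd_ne_auxReg, h.bnd]
    · simp [auxReg_inj, hk.ne]
  | add e f ihe ihf =>
    obtain ⟨s₁, h₁, hr₁, hv₁, hk₁⟩ := ihe h d
    obtain ⟨s₂, h₂, hr₂, hv₂, hk₂⟩ := ihf hr₁ (d + 1)
    refine ⟨_, .seq h₁ (.seq h₂ (.add ..)), hr₂.setAux _ _, ?_, fun k hk => ?_⟩
    · simp [eval, hv₂, hk₂ d (Nat.lt_succ_self d), hv₁]
    · simp [auxReg_inj, hk.ne, hk₂ k (by omega), hk₁ k hk]
  | sub e f ihe ihf =>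
    obtain ⟨s₁, h₁, hr₁, hv₁, hk₁⟩ := ihe h d
    obtain ⟨s₂, h₂, hr₂, hv₂, hk₂⟩ := ihf hr₁ (d + 1)
    refine ⟨_, .seq h₁ (.seq h₂ (.sub ..)), hr₂.setAux _ _, ?_, fun k hk => ?_⟩
    · simp [eval, hv₂, hk₂ d (Nat.lt_succ_self d), hv₁]
    · simp [auxReg_inj, hk.ne, hk₂ k (by omega), hk₁ k hk]
  | get a e ih =>
    obtain ⟨s₁, h₁, hr₁, hv₁, hk₁⟩ := ih h d
    refine ⟨_, .seq h₁ (.load ..), hr₁.setAux _ _, ?_, fun k hk => ?_⟩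
    · simp [eval, hv₁, hr₁.arr]
    · simp [auxReg_inj, hk.ne, hk₁ k hk]

/-- The counter and the number of remaining rounds have constant sum. The 6 per round is five
bookkeeping instructions and the test; the final 1 is the failing test. -/
theorem exec_loop {B : Fin 3 → ℕ} {f : ℕ → Store → Store} {p : Program} {d i T : ℕ}
    (hp : ∀ {s r : Store}, Represents B s r → ∀ j, ∃ n s', Exec p (s.setReg (varReg i) j) n s' ∧
      n ≤ T ∧ Represents B s' (f j r) ∧ ∀ k < d + 2, s'.reg (auxReg k) = s.reg (auxReg k))
    {r : Store} (rem : ℕ) : ∀ {s : Store} {j : ℕ}, Represents B s (iterate f j r) →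
      s.reg (auxReg d) = j → s.reg (auxReg (d + 1)) = rem →
      ∃ n s', Exec (.loop (auxReg (d + 1)) (loopBody d i p)) s n s' ∧ n ≤ rem * (T + 6) + 1 ∧
        Represents B s' (iterate f (j + rem) r) ∧
        ∀ k < d, s'.reg (auxReg k) = s.reg (auxReg k) := by
  induction rem with
  | zero => exact fun {s j} h _ hrem => ⟨_, s, .loop_zero hrem, by simp, h, fun _ _ => rfl⟩
  | succ rem ih =>
    intro s j h hj hrem
    obtain ⟨n₁, s₁, h₁, hn₁, hr₁, hk₁⟩ := hp (h.setAux (d + 2) 0) j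
    let s₂ := s₁.setReg (auxReg (d + 2)) 1
    let s₃ := s₂.setReg (auxReg d) (s₂.reg (auxReg d) + s₂.reg (auxReg (d + 2)))
    let s₄ := s₃.setReg (auxReg (d + 1)) (s₃.reg (auxReg (d + 1)) - s₃.reg (auxReg (d + 2)))
    have hr₄ : Represents B s₄ (iterate f (j + 1) r) :=
      ((hr₁.setAux _ _).setAux _ _).setAux _ _
    have hd : s₁.reg (auxReg d) = j := by simp [hk₁ d (by omega), auxReg_inj, hj]
    have hd1 : s₁.reg (auxReg (d + 1)) = rem + 1 := by
      simp [hk₁ (d + 1) (by omega), auxReg_inj, hrem]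
    obtain ⟨n₂, s₅, h₅, hn₅, hr₅, hk₅⟩ := ih hr₄ (by simp [s₄, s₃, s₂, auxReg_inj, hd])
      (by simp [s₄, s₃, s₂, auxReg_inj, hd1])
    have hbody : Exec (loopBody d i p) s _ s₄ :=
      .seq (.seq (.const ..) (.add ..)) (.seq (by simpa [hj, auxReg_inj] using h₁)
        (.seq (.const ..) (.seq (.add ..) (.sub ..))))
    refine ⟨_, s₅, .loop_pos (by omega) hbody h₅, ?_, ?_, fun k hk => ?_⟩
    · rw [add_one_mul]
      omega
    · rwa [add_assoc, add_comm 1] at hr₅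
    · rw [hk₅ k hk]
      simp [s₄, s₃, s₂, auxReg_inj, hk.ne, show k ≠ d + 1 by omega, show k ≠ d + 2 by omega,
        hk₁ k (by omega)]

theorem Code.exec_compile {B : Fin 3 → ℕ} (c : Code) {s r : Store} (h : Represents B s r)
    (d : ℕ) : ∃ n s', Exec (c.compile d) s n s' ∧ n ≤ c.time B ∧ Represents B s' (c.run B r) ∧
      ∀ k < d, s'.reg (auxReg k) = s.reg (auxReg k) := by
  induction c generalizing s r d with
  | skip => exact ⟨_, s, .skip s, le_rfl, h, fun _ _ => rfl⟩
  | set i e =>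
    obtain ⟨s₁, h₁, hr₁, hv₁, hk₁⟩ := e.exec_compile h d
    refine ⟨_, _, .seq h₁ (.seq (.const ..) (.add ..)), le_rfl, ?_, fun k hk => ?_⟩
    · simpa [auxReg_inj, hv₁, run] using (hr₁.setAux (d + 1) 0).setVar i _
    · simp [varReg_ne_auxReg.symm, auxReg_inj, show k ≠ d + 1 by omega, hk₁ k hk]
  | put a e f =>
    obtain ⟨s₁, h₁, hr₁, hv₁, hk₁⟩ := e.exec_compile h d
    obtain ⟨s₂, h₂, hr₂, hv₂, hk₂⟩ := f.exec_compile hr₁ (d + 1)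
    refine ⟨_, _, .seq h₁ (.seq h₂ (.store ..)), le_rfl, ?_, fun k hk => ?_⟩
    · rw [hv₂, hk₂ d (Nat.lt_succ_self d), hv₁]
      exact hr₂.setArr _ _ _
    · rw [Store.setArr_reg, hk₂ k (by omega), hk₁ k hk]
  | seq p q ihp ihq =>
    obtain ⟨n₁, s₁, h₁, hn₁, hr₁, hk₁⟩ := ihp h d
    obtain ⟨n₂, s₂, h₂, hn₂, hr₂, hk₂⟩ := ihq hr₁ d
    exact ⟨_, _, .seq h₁ h₂, Nat.add_le_add hn₁ hn₂, hr₂, fun k hk => by rw [hk₂ k hk, hk₁ k hk]⟩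
  | cond e p q ihp ihq =>
    obtain ⟨s₁, h₁, hr₁, hv₁, hk₁⟩ := e.exec_compile h d
    by_cases he : 0 < e.eval B r.reg r.arr
    · obtain ⟨n₂, s₂, h₂, hn₂, hr₂, hk₂⟩ := ihp hr₁ d
      refine ⟨_, _, .seq h₁ (.branch_pos (by rwa [hv₁]) h₂), ?_, by rwa [run, if_pos he],
        fun k hk => by rw [hk₂ k hk, hk₁ k hk]⟩
      rw [time]
      omega
    · obtain ⟨n₂, s₂, h₂, hn₂, hr₂, hk₂⟩ := ihq hr₁ d
      refine ⟨_, _, .seq h₁ (.branch_zero (by omega) h₂), ?_, by rwa [run, if_neg he],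
        fun k hk => by rw [hk₂ k hk, hk₁ k hk]⟩
      rw [time]
      omega
  | loop b i p ih =>
    obtain ⟨s₁, h₁, hr₁, hv₁, hk₁⟩ := (Expr.bnd b).exec_compile (h.setAux d 0) (d + 1)
    obtain ⟨n₂, s₂, h₂, hn₂, hr₂, hk₂⟩ := exec_loop (B := B) (d := d) (i := i)
      (f := fun j s => p.run B (s.setReg i j)) (p := p.compile (d + 2)) (T := p.time B)
      (fun {s r} h j => by
        obtain ⟨n, s', he, hn, hr, hk⟩ := ih (h.setVar i j) (d + 2)
        refine ⟨n, s', he, hn, hr, fun k hkd => ?_⟩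
        rw [hk k hkd, Store.setReg_reg, if_neg varReg_ne_auxReg.symm])
      (B b) (s := s₁) (j := 0) (r := r) hr₁
      (by rw [hk₁ d (Nat.lt_succ_self d), Store.setReg_reg, if_pos rfl]) hv₁
    refine ⟨_, s₂, .seq (.const ..) (.seq h₁ h₂), ?_,
      by rw [zero_add] at hr₂; exact hr₂, fun k hk => ?_⟩
    · simp only [Expr.time, time]
      omega
    · rw [hk₂ k hk, hk₁ k (by omega), Store.setReg_reg, if_neg]
      rw [auxReg_inj]
      omega

/-- The exponent of `n` in the running time. -/
def Code.degN : Code → ℕ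
  | skip => 0
  | set _ _ => 0
  | put _ _ _ => 0
  | seq p q => max p.degN q.degN
  | cond _ p q => max p.degN q.degN
  | loop b _ p => p.degN + ![1, 0, 2] b

/-- The exponent of `m` in the running time. -/
def Code.degM : Code → ℕ
  | skip => 0
  | set _ _ => 0
  | put _ _ _ => 0
  | seq p q => max p.degM q.degM
  | cond _ p q => max p.degM q.degM
  | loop b _ p => p.degM + ![0, 1, 0] b

/-- For positive `n` and `m` the monomials are at least 1 and monotone in the exponents, so
constants and sums are absorbed in `K`. -/
theorem Code.time_le (c : Code) : ∃ K, ∀ n m : ℕ, 0 < n → 0 < m →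
    c.time ![n, m, n * n] ≤ K * (n ^ c.degN * m ^ c.degM) := by
  have hmono : ∀ {n m a a' b b' : ℕ}, 0 < n → 0 < m → a ≤ a' → b ≤ b' →
      n ^ a * m ^ b ≤ n ^ a' * m ^ b' := fun hn hm ha hb =>
    Nat.mul_le_mul (Nat.pow_le_pow_right hn ha) (Nat.pow_le_pow_right hm hb)
  induction c with
  | skip => exact ⟨1, fun n m _ _ => by simp [time, degN, degM]⟩
  | set i e => exact ⟨e.time + 2, fun n m _ _ => by simp [time, degN, degM]⟩
  | put a e f => exact ⟨e.time + (f.time + 1), fun n m _ _ => by simp [time, degN, degM]⟩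
  | seq p q ihp ihq =>
    obtain ⟨K, hK⟩ := ihp
    obtain ⟨L, hL⟩ := ihq
    refine ⟨K + L, fun n m hn hm => ?_⟩
    rw [add_mul]
    exact Nat.add_le_add
      ((hK n m hn hm).trans (Nat.mul_le_mul_left _ (hmono hn hm (le_max_left ..) (le_max_left ..))))
      ((hL n m hn hm).trans
        (Nat.mul_le_mul_left _ (hmono hn hm (le_max_right ..) (le_max_right ..))))
  | cond e p q ihp ihq =>
    obtain ⟨K, hK⟩ := ihp
    obtain ⟨L, hL⟩ := ihq
    refine ⟨(e.time + 1) + (K + L), fun n m hn hm => ?_⟩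
    have h1 : e.time + 1 ≤ (e.time + 1) * (n ^ (cond e p q).degN * m ^ (cond e p q).degM) :=
      Nat.le_mul_of_pos_right _ (Nat.mul_pos (Nat.pow_pos hn) (Nat.pow_pos hm))
    have h2 := (hK n m hn hm).trans
      (Nat.mul_le_mul_left K (hmono hn hm (le_max_left p.degN q.degN) (le_max_left p.degM q.degM)))
    have h3 := (hL n m hn hm).trans
      (Nat.mul_le_mul_left L
        (hmono hn hm (le_max_right p.degN q.degN) (le_max_right p.degM q.degM)))
    rw [add_mul, add_mul K L]
    simp only [time, degN, degM] at h1 ⊢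
    omega
  | loop b i p ih =>
    obtain ⟨K, hK⟩ := ih
    refine ⟨K + 6 + 4, fun n m hn hm => ?_⟩
    -- The loop bounds are themselves monomials, so nesting adds exponents.
    have hB : ![n, m, n * n] b = n ^ (![1, 0, 2] b) * m ^ (![0, 1, 0] b) := by
      fin_cases b <;> simp [sq]
    have hpos : ∀ a b : ℕ, 0 < n ^ a * m ^ b := fun a b =>
      Nat.mul_pos (Nat.pow_pos hn) (Nat.pow_pos hm)
    have h1 : p.time ![n, m, n * n] + 6 ≤ (K + 6) * (n ^ p.degN * m ^ p.degM) := by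
      have := Nat.le_mul_of_pos_right 6 (hpos p.degN p.degM)
      rw [add_mul]
      exact Nat.add_le_add (hK n m hn hm) this
    have h2 : n ^ (Code.loop b i p).degN * m ^ (Code.loop b i p).degM =
        ![n, m, n * n] b * (n ^ p.degN * m ^ p.degM) := by
      rw [hB, degN, degM, pow_add, pow_add]
      ring
    rw [add_mul]
    refine Nat.add_le_add ?_ (Nat.le_mul_of_pos_right _ (hpos _ _))
    rw [h2, mul_left_comm]
    exact Nat.mul_le_mul_left _ h1

/-! ### Complete programs -/

/-- Store the square of the content of register 0 in register 2. -/
def squareProgram : Program :=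
  .seq (.const 2 0) (.seq (.const 6 0) (.seq (.add 4 0 6) (.seq (.const 6 1)
    (.loop 4 (.seq (.add 2 2 0) (.sub 4 4 6))))))

/-- Registers 4 and 6 are auxiliary, so variables stay untouched. Overwriting the number of labels
in register 2 is harmless, as labels are only compared with each other and with 0. -/
theorem exec_squareProgram (s : Store) : ∃ s', Exec squareProgram s (3 * s.reg 0 + 5) s' ∧
    s'.arr = s.arr ∧ s'.reg 2 = s.reg 0 * s.reg 0 ∧
    ∀ i, i ≠ 2 → i ≠ 4 → i ≠ 6 → s'.reg i = s.reg i := by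
  have loop : ∀ (k : ℕ) (s : Store), s.reg 4 = k → s.reg 6 = 1 →
      ∃ s', Exec (.loop 4 (.seq (.add 2 2 0) (.sub 4 4 6))) s (3 * k + 1) s' ∧
        s'.arr = s.arr ∧ s'.reg 2 = s.reg 2 + k * s.reg 0 ∧
        ∀ i, i ≠ 2 → i ≠ 4 → i ≠ 6 → s'.reg i = s.reg i := by
    intro k
    induction k with
    | zero => exact fun s h _ => ⟨s, .loop_zero h, rfl, by simp, fun _ _ _ _ => rfl⟩
    | succ k ih =>
      intro s h4 h6
      let s₁ := s.setReg 2 (s.reg 2 + s.reg 0)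
      let s₂ := s₁.setReg 4 (s₁.reg 4 - s₁.reg 6)
      have hb : Exec (.seq (.add 2 2 0) (.sub 4 4 6)) s 2 s₂ := .seq (.add ..) (.sub ..)
      obtain ⟨s', he, ha, h2, hr⟩ := ih s₂ (by simp [s₂, s₁, h4, h6]) (by simp [s₂, s₁, h6])
      refine ⟨s', ?_, ha, ?_, fun i hi hi' hi'' => ?_⟩
      · have := Exec.loop_pos (by omega) hb he
        rwa [show 2 + (3 * k + 1) + 1 = 3 * (k + 1) + 1 by ring] at this
      · rw [h2]
        simp [s₂, s₁]
        ring
      · rw [hr i hi hi' hi'']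
        simp [s₂, s₁, hi, hi']
  let s₁ := (s.setReg 2 0).setReg 6 0
  let s₂ := s₁.setReg 4 (s₁.reg 0 + s₁.reg 6)
  obtain ⟨s', he, ha, h2, hr⟩ := loop (s.reg 0) (s₂.setReg 6 1) (by simp [s₂, s₁])
    (by simp)
  refine ⟨s', ?_, ha, ?_, fun i hi hi' hi'' => ?_⟩
  · have : Exec squareProgram s _ s' :=
      .seq (.const ..) (.seq (.const ..) (.seq (.add ..) (.seq (.const ..) he)))
    rwa [show 1 + (1 + (1 + (1 + (3 * s.reg 0 + 1)))) = 3 * s.reg 0 + 5 by ring] at this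
  · rw [h2]
    simp [s₂, s₁]
  · rw [hr i hi hi' hi'']
    simp [s₂, s₁, hi, hi', hi'']

/-- The program that answers 1 if `n = 0` or `m = 0`, and runs `c` otherwise and answers the
value of variable 0. -/
def Code.program (c : Code) : Program :=
  .branch 0 (.branch 1
    (.seq squareProgram (.seq (c.compile 0) (.seq (.const 4 0) (.add 0 3 4))))
    (.const 0 1)) (.const 0 1)

theorem Code.exec_program {c : Code} (hN : c.degN ≤ 4) (hM : c.degM ≤ 2) :
    ∃ C, ∀ s : Store, (∀ i, s.reg (i + 3) = 0) → ∃ k s', Exec c.program s k s' ∧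
      k ≤ C * (s.reg 0 ^ 4 * s.reg 1 ^ 2 + 1) ∧
      (s.reg 0 = 0 ∨ s.reg 1 = 0 → s'.reg 0 = 1) ∧
      (0 < s.reg 0 → 0 < s.reg 1 → s'.reg 0 =
        (c.run ![s.reg 0, s.reg 1, s.reg 0 * s.reg 0] ⟨fun _ => 0, s.arr⟩).reg 0) := by
  obtain ⟨K, hK⟩ := c.time_le
  -- Apart from `c`, the program takes `3n + 5` steps for the square, two tests and two final
  -- instructions, in all `3n + 9`.
  refine ⟨K + 12, fun s hs => ?_⟩
  have hone : ∀ x : ℕ, 3 ≤ (K + 12) * (x + 1) := fun x => by nlinarith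
  rcases Nat.eq_zero_or_pos (s.reg 0) with h0 | h0
  · exact ⟨_, _, .branch_zero h0 (.const ..), (by omega : 1 + 1 ≤ 3).trans (hone _),
      fun _ => by simp, fun h => absurd h0 h.ne'⟩
  rcases Nat.eq_zero_or_pos (s.reg 1) with h1 | h1
  · exact ⟨_, _, .branch_pos h0 (.branch_zero h1 (.const ..)),
      (by omega : 1 + 1 + 1 ≤ 3).trans (hone _), fun _ => by simp, fun _ h => absurd h1 h.ne'⟩
  obtain ⟨s₁, he₁, ha₁, h2₁, hr₁⟩ := exec_squareProgram s
  have hrep : Represents ![s.reg 0, s.reg 1, s.reg 0 * s.reg 0] s₁ ⟨fun _ => 0, s.arr⟩ := by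
    refine ⟨ha₁, fun i => ?_, fun b => ?_⟩
    · rw [hr₁ _ (by unfold varReg; omega) (by unfold varReg; omega) (by unfold varReg; omega),
        varReg, hs]
    · fin_cases b
      · exact hr₁ 0 (by omega) (by omega) (by omega)
      · exact hr₁ 1 (by omega) (by omega) (by omega)
      · exact h2₁
  obtain ⟨k, s₂, he₂, hk, hrep₂, -⟩ := c.exec_compile hrep 0
  refine ⟨_, _, .branch_pos h0 (.branch_pos h1 (.seq he₁ (.seq he₂ (.seq (.const ..) (.add ..))))),
    ?_, fun h => by omega, fun _ _ => ?_⟩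
  · have hle : s.reg 0 ^ c.degN * s.reg 1 ^ c.degM ≤ s.reg 0 ^ 4 * s.reg 1 ^ 2 :=
      Nat.mul_le_mul (Nat.pow_le_pow_right h0 hN) (Nat.pow_le_pow_right h1 hM)
    have hn : s.reg 0 ≤ s.reg 0 ^ 4 * s.reg 1 ^ 2 :=
      (Nat.le_self_pow (by omega) _).trans (Nat.le_mul_of_pos_right _ (Nat.pow_pos h1))
    have := (hk.trans (hK _ _ h0 h1)).trans (Nat.mul_le_mul_left K hle)
    nlinarith
  · have := hrep₂.var 0
    simp only [varReg] at this
    simpa using this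

theorem iterate_induction {f : ℕ → Store → Store} {P : ℕ → Store → Prop} {n : ℕ} {s : Store}
    (h0 : P 0 s) (hs : ∀ j < n, ∀ s, P j s → P (j + 1) (f j s)) : P n (iterate f n s) := by
  have : ∀ j ≤ n, P j (iterate f j s) := by
    intro j hj
    induction j with
    | zero => exact h0
    | succ j ih => exact hs j hj _ (ih (by omega))
  exact this n le_rfl

/-! ### Marking the cells given by a condition -/

/-- The expression does not read array `a`. -/
def Expr.Avoids (a : ℕ) : Expr → Prop
  | lit _ => True
  | var _ => True
  | bnd _ => True
  | add e f => e.Avoids a ∧ f.Avoids a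
  | sub e f => e.Avoids a ∧ f.Avoids a
  | get b e => b ≠ a ∧ e.Avoids a

theorem Expr.eval_congr {B : Fin 3 → ℕ} {a : ℕ} {ρ : ℕ → ℕ} {M M' : ℕ → ℕ → ℕ} (e : Expr)
    (he : e.Avoids a) (hM : ∀ b, b ≠ a → M b = M' b) : e.eval B ρ M = e.eval B ρ M' := by
  induction e with
  | lit | var | bnd => rfl
  | add e f ihe ihf => rw [eval, eval, ihe he.1, ihf he.2]
  | sub e f ihe ihf => rw [eval, eval, ihe he.1, ihf he.2]
  | get b e ih => rw [eval, eval, ih he.2, hM b he.1]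

/-- Run `c` if all conditions hold. -/
def guarded : List Expr → Code → Code
  | [], c => c
  | e :: L, c => .cond e (guarded L c) .skip

theorem run_guarded_pos {B : Fin 3 → ℕ} {L : List Expr} (c : Code) {s : Store}
    (h : ∀ e ∈ L, 0 < e.eval B s.reg s.arr) : (guarded L c).run B s = c.run B s := by
  induction L with
  | nil => rfl
  | cons e L ih =>
    rw [List.forall_mem_cons] at h
    exact (if_pos h.1).trans (ih h.2)

theorem run_guarded_neg {B : Fin 3 → ℕ} {L : List Expr} (c : Code) {s : Store}
    (h : ¬ ∀ e ∈ L, 0 < e.eval B s.reg s.arr) : (guarded L c).run B s = s := by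
  induction L with
  | nil => simp at h
  | cons e L ih =>
    by_cases he : 0 < e.eval B s.reg s.arr
    · exact (if_pos he).trans (ih fun h' => h (List.forall_mem_cons.2 ⟨he, h'⟩))
    · exact if_neg he

open Classical in
/-- `c` writes 1 to the cells in `Q s` of array `a` and changes nothing else apart from the
variables in `I`; the set `Q s` does not depend on these. -/
structure Marks (B : Fin 3 → ℕ) (c : Code) (a : ℕ) (I : Set ℕ) (Q : Store → Set ℕ) : Prop where
  arr : ∀ s, (c.run B s).arr =
    Function.update s.arr a fun k => if k ∈ Q s then 1 else s.arr a k
  reg : ∀ s, ∀ i ∉ I, (c.run B s).reg i = s.reg i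
  congr : ∀ s s' : Store, (∀ b, b ≠ a → s.arr b = s'.arr b) → (∀ i ∉ I, s.reg i = s'.reg i) →
    Q s = Q s'

/-- Neither the guards nor the address read array `a`, so marking does not affect later decisions.
-/
theorem marks_guarded {B : Fin 3 → ℕ} {a : ℕ} {L : List Expr} {e : Expr}
    (hL : ∀ e ∈ L, e.Avoids a) (he : e.Avoids a) :
    Marks B (guarded L (.put a e (.lit 1))) a ∅ fun s =>
      {k | (∀ e ∈ L, 0 < e.eval B s.reg s.arr) ∧ e.eval B s.reg s.arr = k} where
  arr s := by
    classical
    by_cases h : ∀ e ∈ L, 0 < e.eval B s.reg s.arr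
    · rw [run_guarded_pos _ h, Code.run, Store.setArr_arr]
      congr 1
      ext k
      rw [Function.update_apply]
      by_cases hk : k = e.eval B s.reg s.arr
      · rw [if_pos hk, if_pos ⟨h, hk.symm⟩, Expr.eval]
      · rw [if_neg hk, if_neg fun h' => hk h'.2.symm]
    · rw [run_guarded_neg _ h, eq_comm, Function.update_eq_self_iff]
      ext k
      rw [if_neg fun hk => h hk.1]
  reg s i _ := by
    by_cases h : ∀ e ∈ L, 0 < e.eval B s.reg s.arr
    · rw [run_guarded_pos _ h]
      rfl
    · rw [run_guarded_neg _ h]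
  congr s s' h h' := by
    have hr : s.reg = s'.reg := funext fun i => h' i (by simp)
    ext k
    simp only [Set.mem_ofPred_eq, hr]
    rw [e.eval_congr he h]
    exact and_congr (forall₂_congr fun e' he' => by rw [e'.eval_congr (hL e' he') h]) Iff.rfl

/-- Earlier rounds change only array `a` and variables on which `Q` does not depend. So each round
adds the set determined by the initial store, and the loop marks the union. -/
theorem Marks.loop {B : Fin 3 → ℕ} {c : Code} {a : ℕ} {I : Set ℕ} {Q : Store → Set ℕ}
    (h : Marks B c a I Q) (b : Fin 3) (i : ℕ) :
    Marks B (.loop b i c) a (insert i I) fun s => {k | ∃ j < B b, k ∈ Q (s.setReg i j)} := by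
  classical
  have key : ∀ s, ((Code.loop b i c).run B s).arr = Function.update s.arr a
        (fun k => if ∃ j < B b, k ∈ Q (s.setReg i j) then 1 else s.arr a k) ∧
      ∀ i' ∉ insert i I, ((Code.loop b i c).run B s).reg i' = s.reg i' := by
    intro s
    rw [Code.run]
    refine iterate_induction (P := fun n s' => s'.arr = Function.update s.arr a
      (fun k => if ∃ j < n, k ∈ Q (s.setReg i j) then 1 else s.arr a k) ∧
      ∀ i' ∉ insert i I, s'.reg i' = s.reg i') ⟨by simp, fun _ _ => rfl⟩ ?_
    rintro j - s' ⟨harr, hreg⟩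
    have hQ : Q (s'.setReg i j) = Q (s.setReg i j) := by
      refine h.congr _ _ (fun b hb => ?_) fun i' hi' => ?_
      · rw [Store.setReg_arr, Store.setReg_arr, harr, Function.update_of_ne hb]
      · rw [Store.setReg_reg, Store.setReg_reg]
        split_ifs with hii
        · rfl
        · exact hreg i' (by simp [hii, hi'])
    refine ⟨?_, fun i' hi' => ?_⟩
    · rw [h.arr, hQ, Store.setReg_arr, harr, Function.update_idem]
      congr 1
      ext k
      rw [Function.update_self]
      by_cases h1 : k ∈ Q (s.setReg i j)
      · rw [if_pos h1, if_pos ⟨j, Nat.lt_succ_self j, h1⟩]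
      · rw [if_neg h1]
        refine if_congr ⟨fun ⟨j', hj, hk⟩ => ⟨j', by omega, hk⟩, fun ⟨j', hj, hk⟩ => ?_⟩ rfl rfl
        rcases Nat.lt_succ_iff_lt_or_eq.1 hj with h2 | rfl
        · exact ⟨j', h2, hk⟩
        · exact absurd hk h1
    · rw [Set.mem_insert_iff, not_or] at hi'
      rw [h.reg _ i' hi'.2, Store.setReg_reg, if_neg hi'.1]
      exact hreg i' (by simp [hi'.1, hi'.2])
  refine ⟨fun s => ?_, fun s => (key s).2, fun s s' h1 h2 => ?_⟩
  · rw [(key s).1]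
    congr 1
    ext k
    by_cases h : ∃ j < B b, k ∈ Q (s.setReg i j)
    · rw [if_pos h, if_pos (show k ∈ {k | ∃ j < B b, k ∈ Q (s.setReg i j)} from h)]
    · rw [if_neg h, if_neg (show k ∉ {k | ∃ j < B b, k ∈ Q (s.setReg i j)} from h)]
  · ext k
    refine exists_congr fun j => and_congr Iff.rfl ?_
    rw [h.congr (s.setReg i j) (s'.setReg i j) h1 fun i' hi' => ?_]
    rw [Store.setReg_reg, Store.setReg_reg]
    split_ifs with hii
    · rfl
    · exact h2 i' (by simp [hii, hi'])

/-- For all states `0, 1, 2, 3` and events `4, 5` that satisfy the conditions, write 1 to the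
cell `e` of array `a`. -/
def markAll (a : ℕ) (L : List Expr) (e : Expr) : Code :=
  .loop 0 0 (.loop 0 1 (.loop 0 2 (.loop 0 3 (.loop 1 4 (.loop 1 5
    (guarded L (.put a e (.lit 1))))))))

/-- The variables that `markAll` uses. -/
def tuple (x y z w s t : ℕ) : ℕ → ℕ
  | 0 => x
  | 1 => y
  | 2 => z
  | 3 => w
  | 4 => s
  | 5 => t
  | _ => 0

/-- All variables of the expression have numbers below 6. -/
def Expr.Small : Expr → Prop
  | lit _ => True
  | var i => i < 6
  | bnd _ => True
  | add e f => e.Small ∧ f.Small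
  | sub e f => e.Small ∧ f.Small
  | get _ e => e.Small

theorem Expr.eval_congr_small {B : Fin 3 → ℕ} {ρ ρ' : ℕ → ℕ} {M : ℕ → ℕ → ℕ} (e : Expr)
    (he : e.Small) (h : ∀ i < 6, ρ i = ρ' i) : e.eval B ρ M = e.eval B ρ' M := by
  induction e with
  | lit | bnd => rfl
  | var i => exact h i he
  | add e f ihe ihf => rw [eval, eval, ihe he.1, ihf he.2]
  | sub e f ihe ihf => rw [eval, eval, ihe he.1, ihf he.2]
  | get b e ih => rw [eval, eval, ih he]

/-- All six loops run even if a condition involves fewer variables: the time bound allows it, and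
one lemma serves all tables. As a consequence, nothing is marked when `X` or `T` is empty. -/
theorem run_markAll {X T : Type*} {n m : ℕ} (eX : X ≃ Fin n) (eT : T ≃ Fin m) {V : ℕ} (a : ℕ)
    (L : List Expr) (e : Expr) (hL : ∀ e ∈ L, e.Avoids a ∧ e.Small) (he : e.Avoids a ∧ e.Small)
    (s : Store) : ∃ f, ((markAll a L e).run ![n, m, V] s).arr = Function.update s.arr a f ∧
      ∀ k, 0 < f k ↔ 0 < s.arr a k ∨ ∃ (x y z w : X) (t t' : T),
        (∀ e ∈ L, 0 < e.eval ![n, m, V] (tuple (eX x) (eX y) (eX z) (eX w) (eT t) (eT t')) s.arr) ∧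
        e.eval ![n, m, V] (tuple (eX x) (eX y) (eX z) (eX w) (eT t) (eT t')) s.arr = k := by
  classical
  have h := ((((((marks_guarded (B := ![n, m, V]) (fun e he => (hL e he).1) he.1).loop 1 5).loop
    1 4).loop 0 3).loop 0 2).loop 0 1).loop 0 0
  refine ⟨_, h.arr s, fun k => ?_⟩
  have hX : ∀ P : ℕ → Prop, (∃ j < n, P j) ↔ ∃ x : X, P (eX x) := fun P =>
    ⟨fun ⟨j, hj, hP⟩ => ⟨eX.symm ⟨j, hj⟩, by simpa using hP⟩, fun ⟨x, hP⟩ => ⟨_, (eX x).2, hP⟩⟩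
  have hT : ∀ P : ℕ → Prop, (∃ j < m, P j) ↔ ∃ x : T, P (eT x) := fun P =>
    ⟨fun ⟨j, hj, hP⟩ => ⟨eT.symm ⟨j, hj⟩, by simpa using hP⟩, fun ⟨x, hP⟩ => ⟨_, (eT x).2, hP⟩⟩
  have hQ : ∀ x y z w t t' : ℕ,
      ∀ e' : Expr, e'.Small → e'.eval ![n, m, V] ((((((s.setReg 0 x).setReg 1 y).setReg 2 z).setReg
        3 w).setReg 4 t).setReg 5 t').reg s.arr =
        e'.eval ![n, m, V] (tuple x y z w t t') s.arr := by
    intro x y z w t t' e' he'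
    refine e'.eval_congr_small he' fun i hi => ?_
    interval_cases i <;> simp [tuple]
  simp only [Set.mem_ofPred_eq, Matrix.cons_val_zero, Matrix.cons_val_one, hX, hT,
    Store.setReg_arr]
  simp only [hQ _ _ _ _ _ _ e he.2]
  have hQL : ∀ x y z w t t' : ℕ, (∀ e' ∈ L, 0 < e'.eval ![n, m, V] ((((((s.setReg 0 x).setReg
      1 y).setReg 2 z).setReg 3 w).setReg 4 t).setReg 5 t').reg s.arr) ↔
      ∀ e' ∈ L, 0 < e'.eval ![n, m, V] (tuple x y z w t t') s.arr := fun x y z w t t' =>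
    forall₂_congr fun e' he' => by rw [hQ _ _ _ _ _ _ e' (hL e' he').2]
  simp only [hQL]
  split_ifs with hk
  · simp [hk]
  · simp [hk]

/-! ### Tables of multiples -/

/-- Fill array `a` with the multiples of the value of `e`. -/
def multiples (a : ℕ) (b : Fin 3) (e : Expr) : Code :=
  .seq (.set 7 (.lit 0))
    (.loop b 0 (.seq (.put a (.var 0) (.var 7)) (.set 7 (.add (.var 7) e))))

/-- Variable 7 is the running multiple. Variable 6 may hold the factor, hence the hypothesis on `e`
and the preservation of register 6. -/
theorem run_multiples {B : Fin 3 → ℕ} {a : ℕ} {b : Fin 3} {e : Expr} {s : Store} {c : ℕ}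
    (he : ∀ s' : Store, s'.reg 6 = s.reg 6 → e.eval B s'.reg s'.arr = c) :
    ∃ f, ((multiples a b e).run B s).arr = Function.update s.arr a f ∧
      (∀ i < B b, f i = i * c) ∧ ((multiples a b e).run B s).reg 6 = s.reg 6 := by
  simp only [multiples, Code.run, Expr.eval]
  have := iterate_induction (n := B b) (s := s.setReg 7 0)
    (f := fun j s' => ((((s'.setReg 0 j).setArr a ((s'.setReg 0 j).reg 0)
      ((s'.setReg 0 j).reg 7)).setReg 7
      (((s'.setReg 0 j).setArr a ((s'.setReg 0 j).reg 0) ((s'.setReg 0 j).reg 7)).reg 7 +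
      e.eval B ((s'.setReg 0 j).setArr a ((s'.setReg 0 j).reg 0) ((s'.setReg 0 j).reg 7)).reg
      ((s'.setReg 0 j).setArr a ((s'.setReg 0 j).reg 0) ((s'.setReg 0 j).reg 7)).arr))))
    (P := fun j s' => ∃ f, s'.arr = Function.update s.arr a f ∧ (∀ i < j, f i = i * c) ∧
      s'.reg 6 = s.reg 6 ∧ s'.reg 7 = j * c)
    ⟨s.arr a, by simp, by simp, by simp, by simp⟩ (by
      rintro j - s' ⟨f, ha, hf, h6, h7⟩
      refine ⟨Function.update f j (j * c), ?_, fun i hi => ?_, ?_, ?_⟩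
      · simp [Store.setArr_arr, ha, h7]
      · rw [Function.update_apply]
        split_ifs with h
        · rw [h]
        · exact hf i (by omega)
      · simp [h6]
      · rw [he _ (by simp [h6])]
        simp [h7, add_one_mul])
  obtain ⟨f, h1, h2, h3, -⟩ := this
  exact ⟨f, h1, h2, h3⟩

/-- Array 3 is to hold the multiples of `m * n`, arrays 4 and 5 those of `n`, and array 6 those
of `n * n`. -/
def tables : Code :=
  .seq (.loop 0 0 (.set 6 (.add (.var 6) (.bnd 1))))
    (.seq (multiples 3 0 (.var 6)) (.seq (multiples 4 1 (.bnd 0))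
      (.seq (multiples 5 0 (.bnd 0)) (multiples 6 2 (.bnd 2)))))

/-- Variable 6 accumulates `n * m` by repeated addition, so it has to be 0 at the start. -/
theorem run_tables {n m : ℕ} {s : Store} (h6 : s.reg 6 = 0) :
    ∃ f₃ f₄ f₅ f₆, (tables.run ![n, m, n * n] s).arr = Function.update (Function.update
        (Function.update (Function.update s.arr 3 f₃) 4 f₄) 5 f₅) 6 f₆ ∧
      (∀ i < n, f₃ i = i * (n * m)) ∧ (∀ i < m, f₄ i = i * n) ∧ (∀ i < n, f₅ i = i * n) ∧
      ∀ i < n * n, f₆ i = i * (n * n) := by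
  simp only [tables, Code.run]
  have h := iterate_induction (n := ![n, m, n * n] 0) (s := s)
    (f := fun j s' => (s'.setReg 0 j).setReg 6
      (Expr.eval ![n, m, n * n] (s'.setReg 0 j).reg (s'.setReg 0 j).arr
        (.add (.var 6) (.bnd 1))))
    (P := fun j s' => s'.arr = s.arr ∧ s'.reg 6 = j * m)
    ⟨rfl, by simp [h6]⟩ (by
      rintro j - s' ⟨h1, h2⟩
      exact ⟨h1, by simp [Expr.eval, h2, add_one_mul]⟩)
  obtain ⟨h1, h2⟩ := h
  generalize iterate _ _ s = s₁ at h1 h2 ⊢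
  obtain ⟨f₃, ha₃, hf₃, hr₃⟩ := run_multiples (B := ![n, m, n * n]) (a := 3) (b := 0)
    (e := .var 6) (s := s₁) (c := n * m) (fun s' hs' => by rw [Expr.eval, hs', h2]; rfl)
  generalize (multiples 3 0 (.var 6)).run ![n, m, n * n] s₁ = s₂ at ha₃ hr₃ ⊢
  obtain ⟨f₄, ha₄, hf₄, -⟩ := run_multiples (B := ![n, m, n * n]) (a := 4) (b := 1)
    (e := .bnd 0) (s := s₂) (c := n) (fun s' hs' => rfl)
  generalize (multiples 4 1 (.bnd 0)).run ![n, m, n * n] s₂ = s₃ at ha₄ ⊢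
  obtain ⟨f₅, ha₅, hf₅, -⟩ := run_multiples (B := ![n, m, n * n]) (a := 5) (b := 0)
    (e := .bnd 0) (s := s₃) (c := n) (fun s' hs' => rfl)
  generalize (multiples 5 0 (.bnd 0)).run ![n, m, n * n] s₃ = s₄ at ha₅ ⊢
  obtain ⟨f₆, ha₆, hf₆, -⟩ := run_multiples (B := ![n, m, n * n]) (a := 6) (b := 2)
    (e := .bnd 2) (s := s₄) (c := n * n) (fun s' hs' => rfl)
  exact ⟨f₃, f₄, f₅, f₆, by rw [ha₆, ha₅, ha₄, ha₃, h1], hf₃, hf₄, hf₅, hf₆⟩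

/-! ### Least sets closed under counting rules -/

/-- The edge from vertex `u` to vertex `v`. -/
def edge (a u v : ℕ) : Expr := .get a (.add (.get 6 (.var u)) (.var v))

/-- Select into variable 2 a vertex `v` with `cnt v = 0` that is not done; variable 3 tells
whether there is one. -/
def select (cnt done : ℕ) : Code :=
  .seq (.set 3 (.lit 0)) (.loop 2 1
    (.cond (.sub (.lit 1) (.add (.get done (.var 1)) (.get cnt (.var 1))))
      (.seq (.set 2 (.var 1)) (.set 3 (.lit 1))) .skip))

/-- Set the counters of all successors of the vertex in variable 2 to the value of `x`. -/
def adjust (cnt arc : ℕ) (x : Expr) : Code :=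
  .loop 2 1 (.cond (edge arc 2 1) (.put cnt (.var 1) x) .skip)

/-- Decrement the counters of the successors of the vertex in variable 2. -/
def decrement (cnt arc : ℕ) : Code :=
  adjust cnt arc (.sub (.get cnt (.var 1)) (.lit 1))

/-- Mark in array `done` the least set that contains with `cnt v` many predecessors of a vertex
`v` also `v` itself. -/
def closure (cnt done arc : ℕ) : Code :=
  .loop 2 0 (.seq (select cnt done) (.cond (.var 3)
    (.seq (.put done (.var 2) (.lit 1)) (decrement cnt arc)) .skip))

/-- The guard `1 - (done + cnt)` is positive exactly if both entries vanish; the last candidate of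
the scan wins. -/
theorem run_select {B : Fin 3 → ℕ} (cnt done : ℕ) (s : Store) :
    ((select cnt done).run B s).arr = s.arr ∧
      (((select cnt done).run B s).reg 3 = 0 ∧
          (∀ v < B 2, s.arr cnt v = 0 → s.arr done v ≠ 0) ∨
        0 < ((select cnt done).run B s).reg 3 ∧ ((select cnt done).run B s).reg 2 < B 2 ∧
          s.arr cnt (((select cnt done).run B s).reg 2) = 0 ∧
          s.arr done (((select cnt done).run B s).reg 2) = 0) := by
  simp only [select, Code.run]
  refine iterate_induction (P := fun j s' => s'.arr = s.arr ∧
    (s'.reg 3 = 0 ∧ (∀ v < j, s.arr cnt v = 0 → s.arr done v ≠ 0) ∨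
      0 < s'.reg 3 ∧ s'.reg 2 < B 2 ∧ s.arr cnt (s'.reg 2) = 0 ∧ s.arr done (s'.reg 2) = 0))
    ⟨rfl, .inl ⟨by simp [Expr.eval], by simp⟩⟩ ?_
  rintro j hj s' ⟨ha, h⟩
  by_cases hel : s.arr cnt j = 0 ∧ s.arr done j = 0
  · have : 0 < Expr.eval B (s'.setReg 1 j).reg (s'.setReg 1 j).arr
        (.sub (.lit 1) (.add (.get done (.var 1)) (.get cnt (.var 1)))) := by
      simp [Expr.eval, ha, hel]
    simp only [if_pos this]
    refine ⟨by simp [ha], .inr ?_⟩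
    simp [Expr.eval, hel, hj]
  · have : ¬ 0 < Expr.eval B (s'.setReg 1 j).reg (s'.setReg 1 j).arr
        (.sub (.lit 1) (.add (.get done (.var 1)) (.get cnt (.var 1)))) := by
      simp [Expr.eval, ha]
      omega
    simp only [if_neg this]
    refine ⟨by simp [ha], ?_⟩
    rcases h with ⟨h3, hall⟩ | h
    · refine .inl ⟨by simp [h3], fun v hv hc hd => ?_⟩
      rcases Nat.lt_succ_iff_lt_or_eq.1 hv with h | rfl
      · exact hall v h hc hd
      · exact hel ⟨hc, hd⟩
    · exact .inr (by simpa using h)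

/-- Array 6 holds the row offsets of the adjacency matrix. The function `φ` covers both decrementing
and counting. -/
theorem run_adjust {B : Fin 3 → ℕ} {cnt arc : ℕ} {x : Expr} {φ : ℕ → ℕ} (s : Store)
    (hac : arc ≠ cnt) (h6 : 6 ≠ cnt)
    (hx : ∀ s' : Store, x.eval B s'.reg s'.arr = φ (s'.arr cnt (s'.reg 1))) :
    ((adjust cnt arc x).run B s).arr = Function.update s.arr cnt fun v =>
      if v < B 2 ∧ 0 < s.arr arc (s.arr 6 (s.reg 2) + v) then φ (s.arr cnt v)
      else s.arr cnt v := by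
  simp only [adjust, Code.run]
  refine (iterate_induction (P := fun j s' => s'.arr = Function.update s.arr cnt (fun v =>
      if v < j ∧ 0 < s.arr arc (s.arr 6 (s.reg 2) + v) then φ (s.arr cnt v)
      else s.arr cnt v) ∧ s'.reg 2 = s.reg 2) ⟨by simp, rfl⟩ ?_).1
  rintro j hj s' ⟨ha, h2⟩
  have hev : Expr.eval B (s'.setReg 1 j).reg (s'.setReg 1 j).arr (edge arc 2 1) =
      s.arr arc (s.arr 6 (s.reg 2) + j) := by
    simp [edge, Expr.eval, h2, ha, Function.update_of_ne hac, Function.update_of_ne h6]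
  rw [hev]
  split_ifs with h
  · refine ⟨?_, by simp [h2]⟩
    rw [Store.setArr_arr]
    rw [hx]
    simp only [Expr.eval, Store.setReg_arr, Store.setReg_reg, ha, Function.update_self,
      Function.update_idem, if_true]
    congr 1
    ext v
    rw [Function.update_apply]
    split_ifs <;> first | rfl | omega | (subst_vars; simp_all)
  · refine ⟨?_, by simp [h2]⟩
    rw [Store.setReg_arr, ha]
    congr 1
    ext v
    refine if_congr ⟨fun h => ⟨by omega, h.2⟩, fun h' => ⟨?_, h'.2⟩⟩ rfl rfl
    rcases Nat.lt_succ_iff_lt_or_eq.1 h'.1 with h1 | rfl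
    · exact h1
    · exact absurd h'.2 h

/-- `Q` contains every vertex `v` with at least `c v` predecessors in `Q`. -/
def CountClosed {V : Type*} (c : V → ℕ) (r : V → V → Prop) (Q : Set V) : Prop :=
  ∀ v, c v ≤ {u | u ∈ Q ∧ r u v}.ncard → v ∈ Q

/-- Invariant with the set `D` of processed vertices: `done` marks `D`, the counter of `v` is `c v`
minus its number of predecessors in `D`, `D` lies in every closed set, and after `j` rounds `D` has
at least `j` elements or no vertex is left to select. -/
theorem run_closure {V : Type*} {B : Fin 3 → ℕ} (e : V ≃ Fin (B 2)) {cnt done arc : ℕ}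
    (hcd : cnt ≠ done) (hac : arc ≠ cnt) (had : arc ≠ done) (h6c : 6 ≠ cnt) (h6d : 6 ≠ done)
    {s : Store} (h6 : ∀ i < B 2, s.arr 6 i = i * B 2) {c : V → ℕ} {r : V → V → Prop}
    (hc : ∀ v, s.arr cnt (e v) = c v) (hd : ∀ v, s.arr done (e v) = 0)
    (hr : ∀ u v, 0 < s.arr arc (e u * B 2 + e v) ↔ r u v) :
    ∃ f g, ((closure cnt done arc).run B s).arr =
        Function.update (Function.update s.arr cnt f) done g ∧
      ∀ v, 0 < g (e v) ↔ ∀ Q, CountClosed c r Q → v ∈ Q := by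
  classical
  have : Finite V := .of_equiv _ e.symm
  simp only [closure, Code.run]
  have hinv := iterate_induction (n := B 2) (s := s)
    (f := fun j s' => if 0 < Expr.eval B ((select cnt done).run B (s'.setReg 0 j)).reg
        ((select cnt done).run B (s'.setReg 0 j)).arr (.var 3) then
      (decrement cnt arc).run B (((select cnt done).run B (s'.setReg 0 j)).setArr done
        (Expr.eval B ((select cnt done).run B (s'.setReg 0 j)).reg
          ((select cnt done).run B (s'.setReg 0 j)).arr (.var 2))
        (Expr.eval B ((select cnt done).run B (s'.setReg 0 j)).reg
          ((select cnt done).run B (s'.setReg 0 j)).arr (.lit 1)))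
      else (select cnt done).run B (s'.setReg 0 j))
    (P := fun j s' => ∃ (f g : ℕ → ℕ) (D : Set V),
      s'.arr = Function.update (Function.update s.arr cnt f) done g ∧
      (∀ v, 0 < g (e v) ↔ v ∈ D) ∧ (∀ v, f (e v) = c v - {u | u ∈ D ∧ r u v}.ncard) ∧
      (∀ v ∈ D, f (e v) = 0) ∧ (∀ Q, CountClosed c r Q → D ⊆ Q) ∧
      (j ≤ D.ncard ∨ ∀ v, f (e v) = 0 → v ∈ D))
    ⟨s.arr cnt, s.arr done, ∅, by simp, by simp [hd], by simp [hc], by simp, by simp, by simp⟩ (by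
      rintro j hj s' ⟨f, g, D, ha, hg, hf, hD0, hDQ, hsat⟩
      obtain ⟨ha', hsel⟩ := run_select (B := B) cnt done (s'.setReg 0 j)
      generalize (select cnt done).run B (s'.setReg 0 j) = s₁ at ha' hsel ⊢
      rw [Store.setReg_arr] at ha' hsel
      have hcnt : s'.arr cnt = f := by rw [ha, Function.update_of_ne hcd, Function.update_self]
      have hdone : s'.arr done = g := by rw [ha, Function.update_self]
      rw [hcnt, hdone] at hsel
      rcases hsel with ⟨h3, hno⟩ | ⟨h3, h2, hel, hel'⟩
      · rw [if_neg (show ¬ 0 < Expr.eval B s₁.reg s₁.arr (.var 3) by rw [Expr.eval]; omega)]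
        refine ⟨f, g, D, ha'.trans ha, hg, hf, hD0, hDQ, .inr fun v hv => ?_⟩
        exact (hg v).1 (Nat.pos_of_ne_zero (hno _ (e v).2 hv))
      · rw [if_pos (show 0 < Expr.eval B s₁.reg s₁.arr (.var 3) from h3), decrement,
          run_adjust (φ := fun k => k - 1) _ hac h6c fun _ => rfl]
        simp only [Expr.eval]
        obtain ⟨u, hu⟩ : ∃ u, (e u : ℕ) = s₁.reg 2 := ⟨e.symm ⟨_, h2⟩, by simp⟩
        rw [← hu] at hel hel'
        have huD : u ∉ D := fun h => by
          have := (hg u).2 h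
          omega
        have hcard : ∀ v, {w | w ∈ insert u D ∧ r w v}.ncard =
            {w | w ∈ D ∧ r w v}.ncard + if r u v then 1 else 0 := by
          intro v
          split_ifs with huv
          · rw [← Set.ncard_insert_of_notMem (a := u) (fun h => huD h.1) (Set.toFinite _)]
            congr 1
            ext w
            simp only [Set.mem_ofPred_eq, Set.mem_insert_iff]
            constructor
            · rintro ⟨rfl | h, h'⟩
              · exact .inl rfl
              · exact .inr ⟨h, h'⟩
            · rintro (rfl | h)
              · exact ⟨.inl rfl, huv⟩
              · exact ⟨.inr h.1, h.2⟩
          · rw [add_zero]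
            congr 1
            ext w
            simp only [Set.mem_ofPred_eq, Set.mem_insert_iff]
            constructor
            · rintro ⟨rfl | h, h'⟩
              · exact absurd h' huv
              · exact ⟨h, h'⟩
            · exact fun h => ⟨.inr h.1, h.2⟩
        have harc : ∀ v, 0 < s₁.arr arc (s₁.arr 6 (s₁.reg 2) + e v) ↔ r u v := by
          intro v
          rw [ha', ha, Function.update_of_ne had, Function.update_of_ne hac,
            Function.update_of_ne h6d, Function.update_of_ne h6c, ← hu, h6 _ (e u).2, hr]
        refine ⟨fun v => if v < B 2 ∧ 0 < s₁.arr arc (s₁.arr 6 (s₁.reg 2) + v) then f v - 1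
          else f v, Function.update g (e u) 1, insert u D, ?_, fun v => ?_, fun v => ?_, ?_,
          fun Q hQ => ?_, ?_⟩
        · simp only [Store.setArr_arr, Store.setArr_reg, ha', ha, ← hu]
          ext b k
          simp only [Function.update_apply, hcd, hcd.symm, hac, had, h6c, h6d, if_true, if_false]
          split_ifs <;> simp_all
        · rw [Function.update_apply]
          split_ifs with h
          · have : v = u := e.injective (Fin.ext h)
            simp [this]
          · rw [hg, Set.mem_insert_iff, or_iff_right]
            rintro rfl
            exact h rfl
        · rw [hcard]
          simp only [(e v).2, true_and, harc, hf]
          split_ifs <;> omega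
        · have hz : ∀ v, f (e v) = 0 → (if (e v : ℕ) < B 2 ∧
              0 < s₁.arr arc (s₁.arr 6 (s₁.reg 2) + e v) then f (e v) - 1 else f (e v)) = 0 := by
            intro v hv
            split_ifs <;> omega
          rintro v (rfl | hv)
          · exact hz _ hel
          · exact hz _ (hD0 v hv)
        · refine Set.insert_subset (hQ u ?_) (hDQ Q hQ)
          have h1 := hf u
          have h2 : {w | w ∈ D ∧ r w u}.ncard ≤ {w | w ∈ Q ∧ r w u}.ncard :=
            Set.ncard_le_ncard (fun w hw => ⟨hDQ Q hQ hw.1, hw.2⟩) (Set.toFinite _)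
          omega
        · rcases hsat with h | h
          · left
            rw [Set.ncard_insert_of_notMem huD (Set.toFinite _)]
            omega
          · exact absurd (h u hel) huD)
  obtain ⟨f, g, D, ha, hg, hf, hD0, hDQ, hsat⟩ := hinv
  refine ⟨f, g, ha, fun v => (hg v).trans ⟨fun h Q hQ => hDQ Q hQ h, fun h => h D ?_⟩⟩
  intro v hv
  -- After as many rounds as there are vertices, `D` is everything or nothing can be selected; in
  -- both cases it is closed.
  rcases hsat with h | h
  · have : D = Set.univ := by
      refine Set.eq_of_subset_of_ncard_le (Set.subset_univ _) ?_
      rwa [Set.ncard_univ, Nat.card_congr e, Nat.card_fin]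
    rw [this]
    trivial
  · refine h v ?_
    rw [hf]
    omega

/-! ### Reachability and peeling -/

/-- Mark in array `done` the vertices that are reachable from those marked in array `ini`. -/
def reach (ini cnt done arc : ℕ) : Code :=
  .seq (.loop 2 0 (.put cnt (.var 0) (.sub (.lit 1) (.get ini (.var 0))))) (closure cnt done arc)

/-- Initial vertices get threshold 0 and all others threshold 1, so the least closed set is the set
of reachable vertices. -/
theorem run_reach {V : Type*} {B : Fin 3 → ℕ} {N : ℕ} (hB : B 2 = N) (e : V ≃ Fin N)
    {ini cnt done arc : ℕ}
    (hic : ini ≠ cnt) (hcd : cnt ≠ done) (hac : arc ≠ cnt) (had : arc ≠ done) (h6c : 6 ≠ cnt)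
    (h6d : 6 ≠ done) {s : Store} {M : ℕ → ℕ → ℕ} (hs : s.arr = M)
    (h6 : ∀ i < N, M 6 i = i * N) {I : V → Prop} {r : V → V → Prop}
    (hI : ∀ v, 0 < M ini (e v) ↔ I v) (hd : ∀ v, M done (e v) = 0)
    (hr : ∀ u v, 0 < M arc (e u * N + e v) ↔ r u v) :
    ∃ f g, ((reach ini cnt done arc).run B s).arr =
        Function.update (Function.update M cnt f) done g ∧
      ∀ v, 0 < g (e v) ↔ ∃ u, I u ∧ Relation.ReflTransGen r u v := by
  subst hB
  have : Finite V := .of_equiv _ e.symm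
  have h1 := iterate_induction (n := B 2) (s := s)
    (f := fun j s' => (Code.put cnt (.var 0) (.sub (.lit 1) (.get ini (.var 0)))).run B
      (s'.setReg 0 j))
    (P := fun j s' => ∃ f, s'.arr = Function.update M cnt f ∧ ∀ i < j, f i = 1 - M ini i)
    ⟨M cnt, by simp [hs], by simp⟩ (by
      rintro j - s' ⟨f, ha, hf⟩
      refine ⟨Function.update f j (1 - M ini j), ?_, fun i hi => ?_⟩
      · simp [Code.run, Expr.eval, Store.setArr_arr, ha, Function.update_of_ne hic]
      · rw [Function.update_apply]
        split_ifs with h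
        · rw [h]
        · exact hf i (by omega))
  obtain ⟨f, ha, hf⟩ := h1
  obtain ⟨f', g, hfg, hg⟩ := run_closure (s := (Code.loop 2 0 (.put cnt (.var 0)
      (.sub (.lit 1) (.get ini (.var 0))))).run B s) (c := fun v => 1 - M ini (e v)) (r := r) e hcd
    hac had h6c h6d (fun i hi => by rw [Code.run, ha, Function.update_of_ne h6c, h6 i hi])
    (fun v => by rw [Code.run, ha, Function.update_self, hf _ (e v).2])
    (fun v => by rw [Code.run, ha, Function.update_of_ne hcd.symm, hd])
    (fun u v => by rw [Code.run, ha, Function.update_of_ne hac, hr])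
  refine ⟨f', g, ?_, fun v => (hg v).trans ⟨fun h => ?_, ?_⟩⟩
  · rw [reach, Code.run, hfg, Code.run, ha, Function.update_idem]
  · refine h {v | ∃ u, I u ∧ Relation.ReflTransGen r u v} fun v hv => ?_
    by_cases hIv : I v
    · exact ⟨v, hIv, .refl⟩
    · have h0 : M ini (e v) = 0 := Nat.eq_zero_of_not_pos fun h => hIv ((hI v).1 h)
      replace hv : 1 - M ini (e v) ≤ _ := hv
      rw [h0] at hv
      obtain ⟨w, ⟨u, hu, huw⟩, hwv⟩ := (Set.ncard_pos (Set.toFinite _)).1 hv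
      exact ⟨u, hu, huw.tail hwv⟩
  · rintro ⟨u, hu, huv⟩ Q hQ
    induction huv with
    | refl =>
      have := (hI u).2 hu
      exact hQ u (show 1 - M ini (e u) ≤ _ by omega)
    | @tail b c _ hbc ih =>
      exact hQ c ((Nat.sub_le ..).trans ((Set.ncard_pos (Set.toFinite _)).2 ⟨b, ih, hbc⟩))

/-- Count the predecessors of all vertices. -/
def count (cnt arc : ℕ) : Code :=
  .loop 2 2 (adjust cnt arc (.add (.get cnt (.var 1)) (.lit 1)))

theorem run_count {V : Type*} {B : Fin 3 → ℕ} (e : V ≃ Fin (B 2)) {cnt arc : ℕ}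
    (hac : arc ≠ cnt) (h6c : 6 ≠ cnt) {s : Store} (h6 : ∀ i < B 2, s.arr 6 i = i * B 2)
    {r : V → V → Prop} (hc : ∀ v, s.arr cnt (e v) = 0)
    (hr : ∀ u v, 0 < s.arr arc (e u * B 2 + e v) ↔ r u v) :
    ∃ f, ((count cnt arc).run B s).arr = Function.update s.arr cnt f ∧
      ∀ v, f (e v) = {u | r u v}.ncard := by
  have : Finite V := .of_equiv _ e.symm
  have h := iterate_induction (n := B 2) (s := s)
    (f := fun j s' => (adjust cnt arc (.add (.get cnt (.var 1)) (.lit 1))).run B (s'.setReg 2 j))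
    (P := fun j s' => ∃ f, s'.arr = Function.update s.arr cnt f ∧
      ∀ v, f (e v) = {u | (e u : ℕ) < j ∧ r u v}.ncard)
    ⟨s.arr cnt, by simp, by simp [hc]⟩ (by
      rintro j hj s' ⟨f, ha, hf⟩
      obtain ⟨u, rfl⟩ : ∃ u, (e u : ℕ) = j := ⟨e.symm ⟨j, hj⟩, by simp⟩
      rw [run_adjust (φ := fun k => k + 1) _ hac h6c fun _ => rfl]
      simp only [Store.setReg_arr, Store.setReg_reg, if_true, ha, Function.update_self,
        Function.update_of_ne hac, Function.update_of_ne h6c, Function.update_idem, h6 _ hj]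
      refine ⟨_, rfl, fun v => ?_⟩
      simp only [(e v).2, true_and, hr, hf]
      split_ifs with huv
      · rw [← Set.ncard_insert_of_notMem (a := u) (fun h => lt_irrefl _ h.1) (Set.toFinite _)]
        congr 1
        ext w
        simp only [Set.mem_ofPred_eq, Set.mem_insert_iff]
        constructor
        · rintro (rfl | h)
          · exact ⟨Nat.lt_succ_self _, (hr _ _).1 huv.2⟩
          · exact ⟨by omega, h.2⟩
        · rintro ⟨h1, h2⟩
          rcases Nat.lt_succ_iff_lt_or_eq.1 h1 with h | h
          · exact .inr ⟨h, h2⟩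
          · exact .inl (e.injective (Fin.ext h))
      · congr 1
        ext w
        simp only [Set.mem_ofPred_eq]
        refine ⟨fun h => ⟨by omega, h.2⟩, fun ⟨h1, h2⟩ => ⟨?_, h2⟩⟩
        rcases Nat.lt_succ_iff_lt_or_eq.1 h1 with h | h
        · exact h
        · exact absurd ⟨(e v).2, (hr _ _).2 ((e.injective (Fin.ext h)) ▸ h2)⟩ huv)
  obtain ⟨f, ha, hf⟩ := h
  refine ⟨f, ha, fun v => (hf v).trans ?_⟩
  congr 1
  ext u
  simp

/-- Mark in array `done` the vertices that are not the end of an infinite backward path. -/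
def peel (cnt done arc : ℕ) : Code :=
  .seq (count cnt arc) (closure cnt done arc)

/-- The threshold is the in-degree, so a vertex is marked once all its predecessors are. The
unmarked vertices form the largest set in which every element has a predecessor. -/
theorem run_peel {V : Type*} {B : Fin 3 → ℕ} {N : ℕ} (hB : B 2 = N) (e : V ≃ Fin N)
    {cnt done arc : ℕ}
    (hcd : cnt ≠ done) (hac : arc ≠ cnt) (had : arc ≠ done) (h6c : 6 ≠ cnt)
    (h6d : 6 ≠ done) {s : Store} {M : ℕ → ℕ → ℕ} (hs : s.arr = M)
    (h6 : ∀ i < N, M 6 i = i * N) {r : V → V → Prop}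
    (hc : ∀ v, M cnt (e v) = 0) (hd : ∀ v, M done (e v) = 0)
    (hr : ∀ u v, 0 < M arc (e u * N + e v) ↔ r u v) :
    ∃ f g, ((peel cnt done arc).run B s).arr = Function.update (Function.update M cnt f) done g ∧
      ((∃ v, g (e v) = 0) ↔ ∃ W : Set V, W.Nonempty ∧ ∀ v ∈ W, ∃ u ∈ W, r u v) := by
  subst hB hs
  have : Finite V := .of_equiv _ e.symm
  obtain ⟨f, ha, hf⟩ := run_count e hac h6c h6 hc hr
  obtain ⟨f', g, hfg, hg⟩ := run_closure (s := (count cnt arc).run B s)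
    (c := fun v => {u | r u v}.ncard) (r := r) e hcd hac
    had h6c h6d (fun i hi => by rw [ha, Function.update_of_ne h6c, h6 i hi])
    (fun v => by rw [ha, Function.update_self, hf])
    (fun v => by rw [ha, Function.update_of_ne hcd.symm, hd])
    (fun u v => by rw [ha, Function.update_of_ne hac, hr])
  have hclosed : ∀ Q, CountClosed (fun v => {u | r u v}.ncard) r Q ↔
      ∀ v, (∀ u, r u v → u ∈ Q) → v ∈ Q := by
    refine fun Q => forall_congr' fun v => imp_congr ⟨fun h u hu => ?_, fun h => ?_⟩ Iff.rfl
    · have h1 := Set.eq_of_subset_of_ncard_le (s := {u | u ∈ Q ∧ r u v}) (t := {u | r u v})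
        (fun u hu => hu.2) h (Set.toFinite _)
      have h2 : u ∈ {u | u ∈ Q ∧ r u v} := h1 ▸ hu
      exact h2.1
    · exact Set.ncard_le_ncard (fun u hu => ⟨h u hu, hu⟩) (Set.toFinite _)
  refine ⟨f', g, by rw [peel, Code.run, hfg, ha, Function.update_idem], ⟨?_, ?_⟩⟩
  · rintro ⟨v, hv⟩
    refine ⟨{v | g (e v) = 0}, ⟨v, hv⟩, fun v hv => ?_⟩
    by_contra hno
    push Not at hno
    refine absurd ((hg v).2 fun Q hQ => ?_) (by rw [show g (e v) = 0 from hv]; exact lt_irrefl 0)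
    refine (hclosed Q).1 hQ v fun u hu => ?_
    exact (hg u).1 (Nat.pos_of_ne_zero fun h => hno u h hu) Q hQ
  · rintro ⟨W, ⟨v, hv⟩, hW⟩
    refine ⟨v, Nat.eq_zero_of_not_pos fun h => ?_⟩
    -- The complement of `W` is closed, so no element of `W` is ever marked.
    refine (hg v).1 h Wᶜ ((hclosed _).2 fun v h hvW => ?_) hv
    obtain ⟨u, hu, huv⟩ := hW v hvW
    exact h u huv hu

/-! ### The decision procedure -/

namespace Expr

/-- Equality. -/
def eqE (e f : Expr) : Expr := .sub (.lit 1) (.add (.sub e f) (.sub f e))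

/-- Inequality. -/
def neE (e f : Expr) : Expr := .add (.sub e f) (.sub f e)

/-- The address of the triple of the state `i`, the event `j` and the state `k`. -/
def addr (i j k : ℕ) : Expr := .add (.add (.get 3 (.var i)) (.get 4 (.var j))) (.var k)

/-- The number of the label of the event `j`. -/
def lab (j : ℕ) : Expr := .get 1 (.var j)

/-- The number of the pair of the states `i` and `j`. -/
def pair (i j : ℕ) : Expr := .add (.get 5 (.var i)) (.var j)

/-- The number of the pair of the pairs `i`, `j` and `k`, `l`. -/
def quad (i j k l : ℕ) : Expr := .add (.get 6 (pair i j)) (pair k l)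

theorem eval_eqE_pos {B : Fin 3 → ℕ} {ρ : ℕ → ℕ} {M : ℕ → ℕ → ℕ} {e f : Expr} :
    0 < (eqE e f).eval B ρ M ↔ e.eval B ρ M = f.eval B ρ M := by
  simp only [eqE, eval]
  omega

theorem eval_neE_pos {B : Fin 3 → ℕ} {ρ : ℕ → ℕ} {M : ℕ → ℕ → ℕ} {e f : Expr} :
    0 < (neE e f).eval B ρ M ↔ e.eval B ρ M ≠ f.eval B ρ M := by
  simp only [neE, eval]
  omega

end Expr

open RAM.Expr in
/-- Arrays 10 and 13 receive the reflexive transitive closures of the unobservable and of all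
steps, array 17 the reachable states of the concurrent composition, array 18 the weak steps,
array 19 the reversed relation `LSTS.SplitStep`, array 22 the bifurcation transitions. Cell 0 of
array 23 is set if the automaton is not eventually strongly detectable. -/
def detector : Code :=
  .seq tables <|
  .seq (markAll 7 [.get 0 (addr 1 4 2), eqE (lab 4) (.lit 0)] (quad 0 1 0 2)) <|
  .seq (markAll 8 [] (pair 0 0)) <|
  .seq (reach 8 9 10 7) <|
  .seq (markAll 11 [.get 0 (addr 1 4 2)] (quad 0 1 0 2)) <|
  .seq (reach 8 12 13 11) <|
  .seq (markAll 14 [.get 0 (addr 0 4 2), .get 0 (addr 1 5 3), eqE (lab 4) (lab 5), lab 4]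
    (quad 0 1 2 3)) <|
  .seq (markAll 14 [.get 0 (addr 0 4 2), eqE (lab 4) (.lit 0)] (quad 0 1 2 1)) <|
  .seq (markAll 14 [.get 0 (addr 1 4 2), eqE (lab 4) (.lit 0)] (quad 0 1 0 2)) <|
  .seq (markAll 15 [.get 2 (.var 0), .get 2 (.var 1)] (pair 0 1)) <|
  .seq (reach 15 16 17 14) <|
  .seq (markAll 18 [.get 10 (pair 0 1), .get 0 (addr 1 4 2)] (addr 0 4 2)) <|
  .seq (markAll 19 [neE (.var 0) (.var 1), neE (.var 2) (.var 3), .get 17 (pair 0 1),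
    eqE (lab 4) (lab 5), lab 4, .get 18 (addr 0 4 2), .get 18 (addr 1 5 3)] (quad 2 3 0 1)) <|
  .seq (peel 20 21 19) <|
  .seq (markAll 22 [.get 0 (addr 0 4 1), .get 0 (addr 0 5 2), eqE (lab 5) (.lit 0),
    neE (.var 2) (.var 0)] (pair 0 1)) <|
  .seq (markAll 22 [.get 0 (addr 0 4 1), lab 4, .get 0 (addr 0 5 2), eqE (lab 5) (lab 4),
    neE (.var 2) (.var 1)] (pair 0 1)) <|
  .seq (markAll 23 [eqE (.get 21 (pair 0 1)) (.lit 0)] (.lit 0)) <|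
  .seq (markAll 23 [.get 17 (pair 0 0), .get 22 (pair 0 1), .get 13 (pair 1 0),
    .get 13 (pair 0 2), .get 0 (addr 2 4 3), lab 4, .get 13 (pair 3 0)] (.lit 0)) <|
  .set 0 (.sub (.lit 1) (.get 23 (.lit 0)))

/-- The degree 4 comes from the four state loops of `markAll` and from two nested loops over all
pairs in `closure` and `count`. -/
theorem degN_detector : detector.degN ≤ 4 := by decide

theorem degM_detector : detector.degM ≤ 2 := by decide

/-! ### Numbering of pairs, triples and labels; memory layout -/

section

variable {X : Type u} {T : Type v} {A : Type w} {n m k : ℕ}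

/-- The number of a pair of states. -/
def pairEquiv (eX : X ≃ Fin n) : X × X ≃ Fin (n * n) :=
  (eX.prodCongr eX).trans finProdFinEquiv

/-- The address of a triple of a state, an event and a state. -/
def tripleEquiv (eX : X ≃ Fin n) (eT : T ≃ Fin m) : (X × T) × X ≃ Fin (n * m * n) :=
  (((eX.prodCongr eT).trans finProdFinEquiv).prodCongr eX).trans finProdFinEquiv

/-- The number of a label. -/
def labelNumber (eA : A ≃ Fin k) : Option A → ℕ
  | none => 0
  | some a => eA a + 1

theorem labelNumber_inj {eA : A ≃ Fin k} {a b : Option A} :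
    labelNumber eA a = labelNumber eA b ↔ a = b := by
  cases a <;> cases b <;> simp [labelNumber, ← Fin.ext_iff]

theorem labelNumber_eq_zero {eA : A ≃ Fin k} {a : Option A} :
    labelNumber eA a = 0 ↔ a = none := by
  cases a <;> simp [labelNumber]

theorem labelNumber_pos {eA : A ≃ Fin k} {a : Option A} :
    0 < labelNumber eA a ↔ a ≠ none := by
  rw [Nat.pos_iff_ne_zero, Ne, labelNumber_eq_zero]

theorem mul_add_inj {N K : ℕ} {a a' : Fin N} {b b' : Fin K} :
    (a * K + b : ℕ) = a' * K + b' ↔ a = a' ∧ b = b' := by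
  rw [← Prod.mk.injEq, ← (finProdFinEquiv (m := N) (n := K)).injective.eq_iff, Fin.ext_iff]
  simp only [finProdFinEquiv_apply_val]
  rw [add_comm, mul_comm, add_comm (_ * K), mul_comm _ K]

/-- The arrays `M` contain the automaton `S` and tables of multiples. -/
structure Layout (S : LSTS X T A) (eX : X ≃ Fin n) (eT : T ≃ Fin m) (eA : A ≃ Fin k)
    (M : ℕ → ℕ → ℕ) : Prop where
  trans : ∀ x t y, 0 < M 0 (tripleEquiv eX eT ((x, t), y)) ↔ S.trans x t y
  label : ∀ t, M 1 (eT t) = labelNumber eA (S.label t)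
  init : ∀ x, 0 < M 2 (eX x) ↔ x ∈ S.init
  triple : ∀ x t y, M 3 (eX x) + M 4 (eT t) + eX y = tripleEquiv eX eT ((x, t), y)
  pair : ∀ x y, M 5 (eX x) + eX y = pairEquiv eX (x, y)
  square : ∀ i < n * n, M 6 i = i * (n * n)

theorem Layout.update {S : LSTS X T A} {eX : X ≃ Fin n} {eT : T ≃ Fin m} {eA : A ≃ Fin k}
    {M : ℕ → ℕ → ℕ} (h : Layout S eX eT eA M) {a : ℕ} (ha : 6 < a) (f : ℕ → ℕ) :
    Layout S eX eT eA (Function.update M a f) where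
  trans := by rw [Function.update_of_ne (by omega)]; exact h.trans
  label := by rw [Function.update_of_ne (by omega)]; exact h.label
  init := by rw [Function.update_of_ne (by omega)]; exact h.init
  triple := by
    rw [Function.update_of_ne (by omega), Function.update_of_ne (by omega)]
    exact h.triple
  pair := by rw [Function.update_of_ne (by omega)]; exact h.pair
  square := by rw [Function.update_of_ne (by omega)]; exact h.square

/-- The arrays beyond 6 are still zero, which the later markings and closures need for their
targets. -/
theorem layout_tables (S : LSTS X T A) (eX : X ≃ Fin n) (eT : T ≃ Fin m) (eA : A ≃ Fin k)
    {s : Store} (hs : s.arr = (S.input eX eT eA).arr) (h6 : s.reg 6 = 0) :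
    Layout S eX eT eA (tables.run ![n, m, n * n] s).arr ∧
      ∀ a, 6 < a → ∀ i, (tables.run ![n, m, n * n] s).arr a i = 0 := by
  obtain ⟨f₃, f₄, f₅, f₆, ha, h3, h4, h5, h6⟩ := run_tables (n := n) (m := m) h6
  rw [ha, hs]
  have htr : ∀ x t y, (tripleEquiv eX eT ((x, t), y) : ℕ) = (eX x * m + eT t) * n + eX y := by
    intro x t y
    simp [tripleEquiv]
    ring
  refine ⟨⟨fun x t y => ?_, fun t => ?_, fun x => ?_, fun x t y => ?_, fun x y => ?_, ?_⟩, ?_⟩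
  · have : (∃ x' t' y', (tripleEquiv eX eT ((x, t), y) : ℕ) =
        ((eX x' : ℕ) * m + (eT t' : ℕ)) * n + (eX y' : ℕ) ∧ S.trans x' t' y') ↔
        S.trans x t y := by
      simp only [← htr, ← Fin.ext_iff, (tripleEquiv eX eT).injective.eq_iff, Prod.mk.injEq]
      constructor
      · rintro ⟨x', t', y', ⟨⟨rfl, rfl⟩, rfl⟩, h⟩
        exact h
      · exact fun h => ⟨x, t, y, ⟨⟨rfl, rfl⟩, rfl⟩, h⟩
    simp only [LSTS.input, ne_eq, OfNat.zero_ne_ofNat, not_false_eq_true,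
      Function.update_of_ne]
    split_ifs with h
    · exact iff_of_true one_pos (this.1 h)
    · exact iff_of_false (lt_irrefl 0) fun h' => h (this.2 h')
  · rcases hl : S.label t with _ | a <;> simp [LSTS.input, labelNumber, hl]
  · have : (∃ x', (eX x : ℕ) = eX x' ∧ x' ∈ S.init) ↔ x ∈ S.init := by
      simp only [← Fin.ext_iff, eX.injective.eq_iff]
      simp
    simp only [LSTS.input, ne_eq, not_false_eq_true, Nat.reduceEqDiff,
      Function.update_of_ne]
    split_ifs with h
    · exact iff_of_true one_pos (this.1 h)
    · exact iff_of_false (lt_irrefl 0) fun h' => h (this.2 h')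
  · simp [h3 _ (eX x).2, h4 _ (eT t).2, htr]
    ring
  · simp [h5 _ (eX x).2, pairEquiv]
    ring
  · simpa using h6
  · intro a ha i
    rw [Function.update_of_ne (by omega), Function.update_of_ne (by omega),
      Function.update_of_ne (by omega), Function.update_of_ne (by omega)]
    obtain ⟨a, rfl⟩ := Nat.exists_eq_add_of_le' (show 3 ≤ a by omega)
    rfl

end

/-! ### Correctness of the marking steps -/

section

variable {X : Type u} {T : Type v} {A : Type w} {n m k : ℕ} {S : LSTS X T A} {eX : X ≃ Fin n}
  {eT : T ≃ Fin m} {eA : A ≃ Fin k} {s : Store} {M : ℕ → ℕ → ℕ}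

open RAM.Expr

set_option linter.unusedSimpArgs false

/-- The pattern of all `run_mark` lemmas: `run_markAll` gives an existential over four states and
two events, `Layout` translates the guards into statements about `S`, and loop variables without a
role get arbitrary witnesses. -/
theorem run_mark_epsStep (hs : s.arr = M) (h : Layout S eX eT eA M) :
    ∃ f, ((markAll 7 [.get 0 (addr 1 4 2), eqE (lab 4) (.lit 0)]
        (quad 0 1 0 2)).run ![n, m, n * n] s).arr = Function.update M 7 f ∧
      ∀ p q, 0 < f (pairEquiv eX p * (n * n) + pairEquiv eX q) ↔
        0 < M 7 (pairEquiv eX p * (n * n) + pairEquiv eX q) ∨ p.1 = q.1 ∧ S.EpsStep p.2 q.2 := by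
  subst hs
  obtain ⟨f, ha, hf⟩ := run_markAll eX eT (V := n * n) 7
    [.get 0 (addr 1 4 2), eqE (lab 4) (.lit 0)] (quad 0 1 0 2)
    (by simp [Expr.Avoids, Expr.Small, addr, lab, eqE, neE, Expr.pair, quad])
    (by simp [Expr.Avoids, Expr.Small, addr, lab, eqE, neE, Expr.pair, quad]) s
  refine ⟨f, ha, fun p q => (hf _).trans (or_congr Iff.rfl ?_)⟩
  simp only [List.forall_mem_cons, List.not_mem_nil, false_imp_iff, implies_true, and_true,
    true_and, eval_eqE_pos, eval_neE_pos, Expr.eval, addr, lab, quad, Expr.pair, tuple, h.trans,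
    h.label, h.init, h.triple, h.pair, h.square _ (Fin.is_lt _), labelNumber_eq_zero,
    labelNumber_pos, labelNumber_inj, mul_add_inj, Fin.val_inj, ne_eq,
    EmbeddingLike.apply_eq_iff_eq, Prod.mk.injEq]
  constructor
  · rintro ⟨x, y, z, -, t, -, h, rfl, rfl⟩
    exact ⟨rfl, t, h⟩
  · rintro ⟨hpq, t, h⟩
    exact ⟨p.1, p.2, q.2, p.1, t, t, h, rfl, Prod.ext hpq rfl⟩

theorem run_mark_step (hs : s.arr = M) (h : Layout S eX eT eA M) :
    ∃ f, ((markAll 11 [.get 0 (addr 1 4 2)]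
        (quad 0 1 0 2)).run ![n, m, n * n] s).arr = Function.update M 11 f ∧
      ∀ p q, 0 < f (pairEquiv eX p * (n * n) + pairEquiv eX q) ↔
        0 < M 11 (pairEquiv eX p * (n * n) + pairEquiv eX q) ∨ p.1 = q.1 ∧ S.Step p.2 q.2 := by
  subst hs
  obtain ⟨f, ha, hf⟩ := run_markAll eX eT (V := n * n) 11
    [.get 0 (addr 1 4 2)] (quad 0 1 0 2)
    (by simp [Expr.Avoids, Expr.Small, addr, lab, eqE, neE, Expr.pair, quad])
    (by simp [Expr.Avoids, Expr.Small, addr, lab, eqE, neE, Expr.pair, quad]) s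
  refine ⟨f, ha, fun p q => (hf _).trans (or_congr Iff.rfl ?_)⟩
  simp only [List.forall_mem_cons, List.not_mem_nil, false_imp_iff, implies_true, and_true,
    true_and, eval_eqE_pos, eval_neE_pos, Expr.eval, addr, lab, quad, Expr.pair, tuple, h.trans,
    h.label, h.init, h.triple, h.pair, h.square _ (Fin.is_lt _), labelNumber_eq_zero,
    labelNumber_pos, labelNumber_inj, mul_add_inj, Fin.val_inj, ne_eq,
    EmbeddingLike.apply_eq_iff_eq, Prod.mk.injEq]
  constructor
  · rintro ⟨x, y, z, -, t, -, h, rfl, rfl⟩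
    exact ⟨rfl, t, h⟩
  · rintro ⟨hpq, t, h⟩
    exact ⟨p.1, p.2, q.2, p.1, t, t, h, rfl, Prod.ext hpq rfl⟩

/-- An event must exist because `markAll` also loops over two events that the conditions ignore. -/
theorem run_mark_diag [Nonempty T] (hs : s.arr = M) (h : Layout S eX eT eA M) :
    ∃ f, ((markAll 8 []
        (pair 0 0)).run ![n, m, n * n] s).arr = Function.update M 8 f ∧
      ∀ p, 0 < f (pairEquiv eX p) ↔
        0 < M 8 (pairEquiv eX p) ∨ p.1 = p.2 := by
  subst hs
  obtain ⟨f, ha, hf⟩ := run_markAll eX eT (V := n * n) 8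
    [] (pair 0 0)
    (by simp [Expr.Avoids, Expr.Small, addr, lab, eqE, neE, Expr.pair, quad])
    (by simp [Expr.Avoids, Expr.Small, addr, lab, eqE, neE, Expr.pair, quad]) s
  refine ⟨f, ha, fun p => (hf _).trans (or_congr Iff.rfl ?_)⟩
  simp only [List.forall_mem_cons, List.not_mem_nil, false_imp_iff, implies_true, and_true,
    true_and, eval_eqE_pos, eval_neE_pos, Expr.eval, addr, lab, quad, Expr.pair, tuple, h.trans,
    h.label, h.init, h.triple, h.pair, h.square _ (Fin.is_lt _), labelNumber_eq_zero,
    labelNumber_pos, labelNumber_inj, mul_add_inj, Fin.val_inj, ne_eq,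
    EmbeddingLike.apply_eq_iff_eq, Prod.mk.injEq]
  constructor
  · rintro ⟨x, -, -, -, -, -, rfl⟩
    rfl
  · intro h
    obtain ⟨t⟩ := ‹Nonempty T›
    exact ⟨p.1, p.1, p.1, p.1, t, t, Prod.ext rfl h⟩

theorem run_mark_joint (hs : s.arr = M) (h : Layout S eX eT eA M) :
    ∃ f, ((markAll 14 [.get 0 (addr 0 4 2), .get 0 (addr 1 5 3), eqE (lab 4) (lab 5), lab 4]
        (quad 0 1 2 3)).run ![n, m, n * n] s).arr = Function.update M 14 f ∧
      ∀ p q, 0 < f (pairEquiv eX p * (n * n) + pairEquiv eX q) ↔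
        0 < M 14 (pairEquiv eX p * (n * n) + pairEquiv eX q) ∨
          ∃ t t', S.trans p.1 t q.1 ∧ S.trans p.2 t' q.2 ∧
          S.label t = S.label t' ∧ S.label t ≠ none := by
  subst hs
  obtain ⟨f, ha, hf⟩ := run_markAll eX eT (V := n * n) 14
    [.get 0 (addr 0 4 2), .get 0 (addr 1 5 3), eqE (lab 4) (lab 5), lab 4] (quad 0 1 2 3)
    (by simp [Expr.Avoids, Expr.Small, addr, lab, eqE, neE, Expr.pair, quad])
    (by simp [Expr.Avoids, Expr.Small, addr, lab, eqE, neE, Expr.pair, quad]) s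
  refine ⟨f, ha, fun p q => (hf _).trans (or_congr Iff.rfl ?_)⟩
  simp only [List.forall_mem_cons, List.not_mem_nil, false_imp_iff, implies_true, and_true,
    true_and, eval_eqE_pos, eval_neE_pos, Expr.eval, addr, lab, quad, Expr.pair, tuple, h.trans,
    h.label, h.init, h.triple, h.pair, h.square _ (Fin.is_lt _), labelNumber_eq_zero,
    labelNumber_pos, labelNumber_inj, mul_add_inj, Fin.val_inj, ne_eq,
    EmbeddingLike.apply_eq_iff_eq, Prod.mk.injEq]
  constructor
  · rintro ⟨x, y, z, w, t, t', h, rfl, rfl⟩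
    exact ⟨t, t', h⟩
  · rintro ⟨t, t', h⟩
    exact ⟨p.1, p.2, q.1, q.2, t, t', h, rfl, rfl⟩

theorem run_mark_left (hs : s.arr = M) (h : Layout S eX eT eA M) :
    ∃ f, ((markAll 14 [.get 0 (addr 0 4 2), eqE (lab 4) (.lit 0)]
        (quad 0 1 2 1)).run ![n, m, n * n] s).arr = Function.update M 14 f ∧
      ∀ p q, 0 < f (pairEquiv eX p * (n * n) + pairEquiv eX q) ↔
        0 < M 14 (pairEquiv eX p * (n * n) + pairEquiv eX q) ∨
          ∃ t, S.trans p.1 t q.1 ∧ S.label t = none ∧ p.2 = q.2 := by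
  subst hs
  obtain ⟨f, ha, hf⟩ := run_markAll eX eT (V := n * n) 14
    [.get 0 (addr 0 4 2), eqE (lab 4) (.lit 0)] (quad 0 1 2 1)
    (by simp [Expr.Avoids, Expr.Small, addr, lab, eqE, neE, Expr.pair, quad])
    (by simp [Expr.Avoids, Expr.Small, addr, lab, eqE, neE, Expr.pair, quad]) s
  refine ⟨f, ha, fun p q => (hf _).trans (or_congr Iff.rfl ?_)⟩
  simp only [List.forall_mem_cons, List.not_mem_nil, false_imp_iff, implies_true, and_true,
    true_and, eval_eqE_pos, eval_neE_pos, Expr.eval, addr, lab, quad, Expr.pair, tuple, h.trans,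
    h.label, h.init, h.triple, h.pair, h.square _ (Fin.is_lt _), labelNumber_eq_zero,
    labelNumber_pos, labelNumber_inj, mul_add_inj, Fin.val_inj, ne_eq,
    EmbeddingLike.apply_eq_iff_eq, Prod.mk.injEq]
  constructor
  · rintro ⟨x, y, z, -, t, -, ⟨h, h'⟩, rfl, rfl⟩
    exact ⟨t, h, h', rfl⟩
  · rintro ⟨t, h, h', hpq⟩
    exact ⟨p.1, p.2, q.1, p.1, t, t, ⟨h, h'⟩, rfl, Prod.ext rfl hpq⟩

theorem run_mark_right (hs : s.arr = M) (h : Layout S eX eT eA M) :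
    ∃ f, ((markAll 14 [.get 0 (addr 1 4 2), eqE (lab 4) (.lit 0)]
        (quad 0 1 0 2)).run ![n, m, n * n] s).arr = Function.update M 14 f ∧
      ∀ p q, 0 < f (pairEquiv eX p * (n * n) + pairEquiv eX q) ↔
        0 < M 14 (pairEquiv eX p * (n * n) + pairEquiv eX q) ∨
          ∃ t, S.trans p.2 t q.2 ∧ S.label t = none ∧ p.1 = q.1 := by
  subst hs
  obtain ⟨f, ha, hf⟩ := run_markAll eX eT (V := n * n) 14
    [.get 0 (addr 1 4 2), eqE (lab 4) (.lit 0)] (quad 0 1 0 2)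
    (by simp [Expr.Avoids, Expr.Small, addr, lab, eqE, neE, Expr.pair, quad])
    (by simp [Expr.Avoids, Expr.Small, addr, lab, eqE, neE, Expr.pair, quad]) s
  refine ⟨f, ha, fun p q => (hf _).trans (or_congr Iff.rfl ?_)⟩
  simp only [List.forall_mem_cons, List.not_mem_nil, false_imp_iff, implies_true, and_true,
    true_and, eval_eqE_pos, eval_neE_pos, Expr.eval, addr, lab, quad, Expr.pair, tuple, h.trans,
    h.label, h.init, h.triple, h.pair, h.square _ (Fin.is_lt _), labelNumber_eq_zero,
    labelNumber_pos, labelNumber_inj, mul_add_inj, Fin.val_inj, ne_eq,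
    EmbeddingLike.apply_eq_iff_eq, Prod.mk.injEq]
  constructor
  · rintro ⟨x, y, z, -, t, -, ⟨h, h'⟩, rfl, rfl⟩
    exact ⟨t, h, h', rfl⟩
  · rintro ⟨t, h, h', hpq⟩
    exact ⟨p.1, p.2, q.2, p.1, t, t, ⟨h, h'⟩, rfl, Prod.ext hpq rfl⟩

theorem run_mark_init [Nonempty T] (hs : s.arr = M) (h : Layout S eX eT eA M) :
    ∃ f, ((markAll 15 [.get 2 (.var 0), .get 2 (.var 1)]
        (pair 0 1)).run ![n, m, n * n] s).arr = Function.update M 15 f ∧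
      ∀ p, 0 < f (pairEquiv eX p) ↔
        0 < M 15 (pairEquiv eX p) ∨ p ∈ S.cc.init := by
  subst hs
  obtain ⟨f, ha, hf⟩ := run_markAll eX eT (V := n * n) 15
    [.get 2 (.var 0), .get 2 (.var 1)] (pair 0 1)
    (by simp [Expr.Avoids, Expr.Small, addr, lab, eqE, neE, Expr.pair, quad])
    (by simp [Expr.Avoids, Expr.Small, addr, lab, eqE, neE, Expr.pair, quad]) s
  refine ⟨f, ha, fun p => (hf _).trans (or_congr Iff.rfl ?_)⟩
  simp only [List.forall_mem_cons, List.not_mem_nil, false_imp_iff, implies_true, and_true,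
    true_and, eval_eqE_pos, eval_neE_pos, Expr.eval, addr, lab, quad, Expr.pair, tuple, h.trans,
    h.label, h.init, h.triple, h.pair, h.square _ (Fin.is_lt _), labelNumber_eq_zero,
    labelNumber_pos, labelNumber_inj, mul_add_inj, Fin.val_inj, ne_eq,
    EmbeddingLike.apply_eq_iff_eq, Prod.mk.injEq]
  constructor
  · rintro ⟨x, y, -, -, -, -, h, rfl⟩
    exact h
  · intro h
    obtain ⟨t⟩ := ‹Nonempty T›
    exact ⟨p.1, p.2, p.1, p.1, t, t, h, rfl⟩

theorem run_mark_weakStep (hs : s.arr = M) (h : Layout S eX eT eA M)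
    (h10 : ∀ p, 0 < M 10 (pairEquiv eX p) ↔ Relation.ReflTransGen S.EpsStep p.1 p.2) :
    ∃ f, ((markAll 18 [.get 10 (pair 0 1), .get 0 (addr 1 4 2)]
        (addr 0 4 2)).run ![n, m, n * n] s).arr = Function.update M 18 f ∧
      ∀ x t y, 0 < f (tripleEquiv eX eT ((x, t), y)) ↔
        0 < M 18 (tripleEquiv eX eT ((x, t), y)) ∨ S.WeakStep x t y := by
  subst hs
  obtain ⟨f, ha, hf⟩ := run_markAll eX eT (V := n * n) 18
    [.get 10 (pair 0 1), .get 0 (addr 1 4 2)] (addr 0 4 2)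
    (by simp [Expr.Avoids, Expr.Small, addr, lab, eqE, neE, Expr.pair, quad])
    (by simp [Expr.Avoids, Expr.Small, addr, lab, eqE, neE, Expr.pair, quad]) s
  refine ⟨f, ha, fun x t y => (hf _).trans (or_congr Iff.rfl ?_)⟩
  simp only [List.forall_mem_cons, List.not_mem_nil, false_imp_iff, implies_true, and_true,
    true_and, eval_eqE_pos, eval_neE_pos, Expr.eval, addr, lab, quad, Expr.pair, tuple, h.trans,
    h.label, h.init, h.triple, h.pair, h.square _ (Fin.is_lt _), labelNumber_eq_zero,
    labelNumber_pos, labelNumber_inj, mul_add_inj, Fin.val_inj, ne_eq,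
    EmbeddingLike.apply_eq_iff_eq, Prod.mk.injEq, h10]
  constructor
  · rintro ⟨x, z, y, -, t, -, ⟨h, h'⟩, ⟨rfl, rfl⟩, rfl⟩
    exact ⟨z, h, h'⟩
  · rintro ⟨z, h, h'⟩
    exact ⟨x, z, y, x, t, t, ⟨h, h'⟩, ⟨rfl, rfl⟩, rfl⟩

/-- The relation is stored reversed, since `peel` looks for predecessors whereas `StaysSplit` asks
for successors. -/
theorem run_mark_splitStep (hs : s.arr = M) (h : Layout S eX eT eA M)
    (h17 : ∀ p, 0 < M 17 (pairEquiv eX p) ↔ S.cc.Reachable p)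
    (h18 : ∀ x t y, 0 < M 18 (tripleEquiv eX eT ((x, t), y)) ↔ S.WeakStep x t y) :
    ∃ f, ((markAll 19 [neE (.var 0) (.var 1), neE (.var 2) (.var 3), .get 17 (pair 0 1),
      eqE (lab 4) (lab 5), lab 4, .get 18 (addr 0 4 2), .get 18 (addr 1 5 3)]
        (quad 2 3 0 1)).run ![n, m, n * n] s).arr = Function.update M 19 f ∧
      ∀ p q, 0 < f (pairEquiv eX p * (n * n) + pairEquiv eX q) ↔
        0 < M 19 (pairEquiv eX p * (n * n) + pairEquiv eX q) ∨ S.SplitStep q p := by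
  subst hs
  obtain ⟨f, ha, hf⟩ := run_markAll eX eT (V := n * n) 19
    [neE (.var 0) (.var 1), neE (.var 2) (.var 3), .get 17 (pair 0 1),
      eqE (lab 4) (lab 5), lab 4, .get 18 (addr 0 4 2), .get 18 (addr 1 5 3)] (quad 2 3 0 1)
    (by simp [Expr.Avoids, Expr.Small, addr, lab, eqE, neE, Expr.pair, quad])
    (by simp [Expr.Avoids, Expr.Small, addr, lab, eqE, neE, Expr.pair, quad]) s
  refine ⟨f, ha, fun p q => (hf _).trans (or_congr Iff.rfl ?_)⟩
  simp only [List.forall_mem_cons, List.not_mem_nil, false_imp_iff, implies_true, and_true,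
    true_and, eval_eqE_pos, eval_neE_pos, Expr.eval, addr, lab, quad, Expr.pair, tuple, h.trans,
    h.label, h.init, h.triple, h.pair, h.square _ (Fin.is_lt _), labelNumber_eq_zero,
    labelNumber_pos, labelNumber_inj, mul_add_inj, Fin.val_inj, ne_eq,
    EmbeddingLike.apply_eq_iff_eq, Prod.mk.injEq, h17, h18]
  constructor
  · rintro ⟨x, y, z, w, t, t', ⟨h1, h2, h3, h⟩, rfl, rfl⟩
    exact ⟨h1, h2, h3, t, t', h⟩
  · rintro ⟨h1, h2, h3, t, t', h⟩
    exact ⟨q.1, q.2, p.1, p.2, t, t', ⟨h1, h2, h3, h⟩, rfl, rfl⟩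

theorem run_mark_epsBifurcation (hs : s.arr = M) (h : Layout S eX eT eA M) :
    ∃ f, ((markAll 22 [.get 0 (addr 0 4 1), .get 0 (addr 0 5 2), eqE (lab 5) (.lit 0),
      neE (.var 2) (.var 0)]
        (pair 0 1)).run ![n, m, n * n] s).arr = Function.update M 22 f ∧
      ∀ p, 0 < f (pairEquiv eX p) ↔
        0 < M 22 (pairEquiv eX p) ∨
          S.Step p.1 p.2 ∧ ∃ t j', S.trans p.1 t j' ∧ S.label t = none ∧ j' ≠ p.1 := by
  subst hs
  obtain ⟨f, ha, hf⟩ := run_markAll eX eT (V := n * n) 22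
    [.get 0 (addr 0 4 1), .get 0 (addr 0 5 2), eqE (lab 5) (.lit 0),
      neE (.var 2) (.var 0)] (pair 0 1)
    (by simp [Expr.Avoids, Expr.Small, addr, lab, eqE, neE, Expr.pair, quad])
    (by simp [Expr.Avoids, Expr.Small, addr, lab, eqE, neE, Expr.pair, quad]) s
  refine ⟨f, ha, fun p => (hf _).trans (or_congr Iff.rfl ?_)⟩
  simp only [List.forall_mem_cons, List.not_mem_nil, false_imp_iff, implies_true, and_true,
    true_and, eval_eqE_pos, eval_neE_pos, Expr.eval, addr, lab, quad, Expr.pair, tuple, h.trans,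
    h.label, h.init, h.triple, h.pair, h.square _ (Fin.is_lt _), labelNumber_eq_zero,
    labelNumber_pos, labelNumber_inj, mul_add_inj, Fin.val_inj, ne_eq,
    EmbeddingLike.apply_eq_iff_eq, Prod.mk.injEq]
  constructor
  · rintro ⟨x, y, z, -, t, t', ⟨h, h'⟩, rfl⟩
    exact ⟨⟨t, h⟩, t', z, h'⟩
  · rintro ⟨⟨t, h⟩, t', z, h'⟩
    exact ⟨p.1, p.2, z, z, t, t', ⟨h, h'⟩, rfl⟩

theorem run_mark_labelBifurcation (hs : s.arr = M) (h : Layout S eX eT eA M) :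
    ∃ f, ((markAll 22 [.get 0 (addr 0 4 1), lab 4, .get 0 (addr 0 5 2), eqE (lab 5) (lab 4),
      neE (.var 2) (.var 1)]
        (pair 0 1)).run ![n, m, n * n] s).arr = Function.update M 22 f ∧
      ∀ p, 0 < f (pairEquiv eX p) ↔
        0 < M 22 (pairEquiv eX p) ∨
          ∃ t t' j', S.trans p.1 t p.2 ∧ S.label t ≠ none ∧
          S.trans p.1 t' j' ∧ S.label t' = S.label t ∧ j' ≠ p.2 := by
  subst hs
  obtain ⟨f, ha, hf⟩ := run_markAll eX eT (V := n * n) 22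
    [.get 0 (addr 0 4 1), lab 4, .get 0 (addr 0 5 2), eqE (lab 5) (lab 4),
      neE (.var 2) (.var 1)] (pair 0 1)
    (by simp [Expr.Avoids, Expr.Small, addr, lab, eqE, neE, Expr.pair, quad])
    (by simp [Expr.Avoids, Expr.Small, addr, lab, eqE, neE, Expr.pair, quad]) s
  refine ⟨f, ha, fun p => (hf _).trans (or_congr Iff.rfl ?_)⟩
  simp only [List.forall_mem_cons, List.not_mem_nil, false_imp_iff, implies_true, and_true,
    true_and, eval_eqE_pos, eval_neE_pos, Expr.eval, addr, lab, quad, Expr.pair, tuple, h.trans,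
    h.label, h.init, h.triple, h.pair, h.square _ (Fin.is_lt _), labelNumber_eq_zero,
    labelNumber_pos, labelNumber_inj, mul_add_inj, Fin.val_inj, ne_eq,
    EmbeddingLike.apply_eq_iff_eq, Prod.mk.injEq]
  constructor
  · rintro ⟨x, y, z, -, t, t', h, rfl⟩
    exact ⟨t, t', z, h⟩
  · rintro ⟨t, t', z, h⟩
    exact ⟨p.1, p.2, z, z, t, t', h, rfl⟩

theorem run_mark_staysSplit [Nonempty T] (hs : s.arr = M) (h : Layout S eX eT eA M) :
    ∃ f, ((markAll 23 [eqE (.get 21 (pair 0 1)) (.lit 0)]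
        (.lit 0)).run ![n, m, n * n] s).arr = Function.update M 23 f ∧
      (0 < f 0 ↔
        0 < M 23 0 ∨ ∃ p, M 21 (pairEquiv eX p) = 0) := by
  subst hs
  obtain ⟨f, ha, hf⟩ := run_markAll eX eT (V := n * n) 23
    [eqE (.get 21 (pair 0 1)) (.lit 0)] (.lit 0)
    (by simp [Expr.Avoids, Expr.Small, addr, lab, eqE, neE, Expr.pair, quad])
    (by simp [Expr.Avoids, Expr.Small, addr, lab, eqE, neE, Expr.pair, quad]) s
  refine ⟨f, ha, (hf _).trans (or_congr Iff.rfl ?_)⟩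
  simp only [List.forall_mem_cons, List.not_mem_nil, false_imp_iff, implies_true, and_true,
    true_and, eval_eqE_pos, eval_neE_pos, Expr.eval, addr, lab, quad, Expr.pair, tuple, h.trans,
    h.label, h.init, h.triple, h.pair, h.square _ (Fin.is_lt _), labelNumber_eq_zero,
    labelNumber_pos, labelNumber_inj, mul_add_inj, Fin.val_inj, ne_eq,
    EmbeddingLike.apply_eq_iff_eq, Prod.mk.injEq]
  constructor
  · rintro ⟨x, y, -, -, -, -, h⟩
    exact ⟨_, h⟩
  · rintro ⟨p, h⟩
    obtain ⟨t⟩ := ‹Nonempty T›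
    exact ⟨p.1, p.2, p.1, p.1, t, t, h⟩

/-- Reachability of a state is read from the diagonal of the concurrent composition, by
`cc_reachable_diag`. -/
theorem run_mark_rebranches (hs : s.arr = M) (h : Layout S eX eT eA M)
    (h13 : ∀ p, 0 < M 13 (pairEquiv eX p) ↔ Relation.ReflTransGen S.Step p.1 p.2)
    (h17 : ∀ p, 0 < M 17 (pairEquiv eX p) ↔ S.cc.Reachable p)
    (h22 : ∀ p, 0 < M 22 (pairEquiv eX p) ↔ S.BifurcationEdge p.1 p.2) :
    ∃ f, ((markAll 23 [.get 17 (pair 0 0), .get 22 (pair 0 1), .get 13 (pair 1 0),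
      .get 13 (pair 0 2), .get 0 (addr 2 4 3), lab 4, .get 13 (pair 3 0)]
        (.lit 0)).run ![n, m, n * n] s).arr = Function.update M 23 f ∧
      (0 < f 0 ↔
        0 < M 23 0 ∨ S.Rebranches) := by
  subst hs
  obtain ⟨f, ha, hf⟩ := run_markAll eX eT (V := n * n) 23
    [.get 17 (pair 0 0), .get 22 (pair 0 1), .get 13 (pair 1 0),
      .get 13 (pair 0 2), .get 0 (addr 2 4 3), lab 4, .get 13 (pair 3 0)] (.lit 0)
    (by simp [Expr.Avoids, Expr.Small, addr, lab, eqE, neE, Expr.pair, quad])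
    (by simp [Expr.Avoids, Expr.Small, addr, lab, eqE, neE, Expr.pair, quad]) s
  refine ⟨f, ha, (hf _).trans (or_congr Iff.rfl ?_)⟩
  simp only [List.forall_mem_cons, List.not_mem_nil, false_imp_iff, implies_true, and_true,
    true_and, eval_eqE_pos, eval_neE_pos, Expr.eval, addr, lab, quad, Expr.pair, tuple, h.trans,
    h.label, h.init, h.triple, h.pair, h.square _ (Fin.is_lt _), labelNumber_eq_zero,
    labelNumber_pos, labelNumber_inj, mul_add_inj, Fin.val_inj, ne_eq,
    EmbeddingLike.apply_eq_iff_eq, Prod.mk.injEq, h13, h17, h22, LSTS.cc_reachable_diag]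
  constructor
  · rintro ⟨j, i, p, q, t, -, h1, h2, h3, h4, h5, h6, h7⟩
    exact ⟨j, i, p, q, t, h1, h2, h3, h4, h5, h6, h7⟩
  · rintro ⟨j, i, p, q, t, h1, h2, h3, h4, h5, h6, h7⟩
    exact ⟨j, i, p, q, t, t, h1, h2, h3, h4, h5, h6, h7⟩

end

/-! ### Correctness of the detector -/

section

variable {X : Type u} {T : Type v} {A : Type w} {n m k : ℕ}

/-- A reflexive transitive closure on `X` becomes reachability from the diagonal in a graph on `X ×
X` whose first component is frozen, so `reach` can compute it. -/
theorem reflTransGen_snd {r : X → X → Prop} {p : X × X} :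
    (∃ q : X × X, q.1 = q.2 ∧ Relation.ReflTransGen (fun p q => p.1 = q.1 ∧ r p.2 q.2) q p) ↔
      Relation.ReflTransGen r p.1 p.2 := by
  constructor
  · rintro ⟨q, hq, h⟩
    induction h with
    | refl => rw [hq]
    | tail _ h ih => exact h.1 ▸ ih.tail h.2
  · obtain ⟨x, y⟩ := p
    intro h
    refine ⟨(x, x), rfl, ?_⟩
    change Relation.ReflTransGen r x y at h
    induction h with
    | refl => exact .refl
    | tail _ h ih => exact ih.tail ⟨rfl, h⟩

theorem cc_reachable_iff {S : LSTS X T A} {p : X × X} :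
    (∃ q ∈ S.cc.init, Relation.ReflTransGen S.cc.Step q p) ↔ S.cc.Reachable p :=
  exists_congr fun _ => and_congr Iff.rfl LSTS.reflTransGen_step_iff

theorem run_detector [Nonempty T] (S : LSTS X T A) (eX : X ≃ Fin n) (eT : T ≃ Fin m)
    (eA : A ≃ Fin k) :
    ∃ b, (detector.run ![n, m, n * n] ⟨fun _ => 0, (S.input eX eT eA).arr⟩).reg 0 = 1 - b ∧
      (0 < b ↔ S.StaysSplit ∨ S.Rebranches) := by
  obtain ⟨hL, hz⟩ := layout_tables S eX eT eA (s := ⟨fun _ => 0, (S.input eX eT eA).arr⟩) rfl rfl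
  simp only [detector, Code.run]
  generalize hM : (tables.run ![n, m, n * n] ⟨fun _ => 0, (S.input eX eT eA).arr⟩) = s₀ at hL hz ⊢
  obtain ⟨M, rfl⟩ : ∃ M, s₀.arr = M := ⟨_, rfl⟩
  obtain ⟨f₇, a₇, h₇⟩ := run_mark_epsStep rfl hL
  -- Each stage writes only arrays above 6, so the layout persists; earlier results stay readable
  -- through the chain of updates.
  have L := hL.update (a := 7) (by omega) f₇
  generalize Code.run _ _ s₀ = s at a₇ ⊢
  obtain ⟨f₈, a₈, h₈⟩ := run_mark_diag a₇ L
  replace L := L.update (a := 8) (by omega) f₈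
  generalize Code.run _ _ s = s at a₈ ⊢
  obtain ⟨f₉, f₁₀, a₁₀, h₁₀⟩ := run_reach (B := ![n, m, n * n]) (ini := 8) (cnt := 9) (done := 10)
    (arc := 7) (N := n * n) rfl
    (pairEquiv eX) (by decide) (by decide) (by decide) (by decide) (by decide)
    (by decide) a₈ L.square (I := fun p => p.1 = p.2)
    (r := fun p q => p.1 = q.1 ∧ S.EpsStep p.2 q.2)
    (fun p => by simpa [hz] using h₈ p) (fun p => by simp [hz])
    (fun p q => by simpa [hz] using h₇ p q)
  replace h₁₀ := fun p => (h₁₀ p).trans reflTransGen_snd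
  replace L := (L.update (a := 9) (by omega) f₉).update (a := 10) (by omega) f₁₀
  generalize Code.run _ _ s = s at a₁₀ ⊢
  obtain ⟨f₁₁, a₁₁, h₁₁⟩ := run_mark_step a₁₀ L
  replace L := L.update (a := 11) (by omega) f₁₁
  generalize Code.run _ _ s = s at a₁₁ ⊢
  obtain ⟨f₁₂, f₁₃, a₁₃, h₁₃⟩ := run_reach (B := ![n, m, n * n]) (ini := 8) (cnt := 12)
    (done := 13) (arc := 11) (N := n * n) rfl
    (pairEquiv eX) (by decide) (by decide) (by decide) (by decide)
    (by decide) (by decide) a₁₁ L.square (I := fun p => p.1 = p.2)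
    (r := fun p q => p.1 = q.1 ∧ S.Step p.2 q.2)
    (fun p => by simpa [hz] using h₈ p) (fun p => by simp [hz])
    (fun p q => by simpa [hz] using h₁₁ p q)
  replace h₁₃ := fun p => (h₁₃ p).trans reflTransGen_snd
  replace L := (L.update (a := 12) (by omega) f₁₂).update (a := 13) (by omega) f₁₃
  generalize Code.run _ _ s = s at a₁₃ ⊢
  obtain ⟨f₁₄, a₁₄, h₁₄⟩ := run_mark_joint a₁₃ L
  replace L := L.update (a := 14) (by omega) f₁₄
  generalize Code.run _ _ s = s at a₁₄ ⊢
  obtain ⟨g₁₄, b₁₄, k₁₄⟩ := run_mark_left a₁₄ L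
  replace L := L.update (a := 14) (by omega) g₁₄
  generalize Code.run _ _ s = s at b₁₄ ⊢
  obtain ⟨l₁₄, c₁₄, j₁₄⟩ := run_mark_right b₁₄ L
  replace L := L.update (a := 14) (by omega) l₁₄
  generalize Code.run _ _ s = s at c₁₄ ⊢
  obtain ⟨f₁₅, a₁₅, h₁₅⟩ := run_mark_init c₁₄ L
  replace L := L.update (a := 15) (by omega) f₁₅
  generalize Code.run _ _ s = s at a₁₅ ⊢
  obtain ⟨f₁₆, f₁₇, a₁₇, h₁₇⟩ := run_reach (B := ![n, m, n * n]) (ini := 15) (cnt := 16)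
    (done := 17) (arc := 14) (N := n * n) rfl
    (pairEquiv eX) (by decide) (by decide) (by decide) (by decide)
    (by decide) (by decide) a₁₅ L.square (I := fun p => p ∈ S.cc.init) (r := S.cc.Step)
    (fun p => by simpa [hz] using h₁₅ p) (fun p => by simp [hz])
    (fun p q => by
      rw [LSTS.cc_step_iff]
      simpa [hz, h₁₄, k₁₄, or_assoc] using j₁₄ p q)
  replace h₁₇ := fun p => (h₁₇ p).trans cc_reachable_iff
  replace L := (L.update (a := 16) (by omega) f₁₆).update (a := 17) (by omega) f₁₇
  generalize Code.run _ _ s = s at a₁₇ ⊢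
  obtain ⟨f₁₈, a₁₈, h₁₈⟩ := run_mark_weakStep a₁₇ L (fun p => by simpa using h₁₀ p)
  replace L := L.update (a := 18) (by omega) f₁₈
  generalize Code.run _ _ s = s at a₁₈ ⊢
  obtain ⟨f₁₉, a₁₉, h₁₉⟩ := run_mark_splitStep a₁₈ L (fun p => by simpa using h₁₇ p)
    (fun x t y => by simpa [hz] using h₁₈ x t y)
  replace L := L.update (a := 19) (by omega) f₁₉
  generalize Code.run _ _ s = s at a₁₉ ⊢
  obtain ⟨f₂₀, f₂₁, a₂₁, h₂₁⟩ := run_peel (B := ![n, m, n * n]) (cnt := 20) (done := 21)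
    (arc := 19) (N := n * n) rfl
    (pairEquiv eX) (by decide) (by decide) (by decide) (by decide) (by decide)
    a₁₉ L.square (r := fun p q => S.SplitStep q p) (fun p => by simp [hz])
    (fun p => by simp [hz]) (fun p q => by simpa [hz] using h₁₉ p q)
  replace L := (L.update (a := 20) (by omega) f₂₀).update (a := 21) (by omega) f₂₁
  generalize Code.run _ _ s = s at a₂₁ ⊢
  obtain ⟨f₂₂, a₂₂, h₂₂⟩ := run_mark_epsBifurcation a₂₁ L
  replace L := L.update (a := 22) (by omega) f₂₂
  generalize Code.run _ _ s = s at a₂₂ ⊢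
  obtain ⟨g₂₂, b₂₂, k₂₂⟩ := run_mark_labelBifurcation a₂₂ L
  replace L := L.update (a := 22) (by omega) g₂₂
  generalize Code.run _ _ s = s at b₂₂ ⊢
  obtain ⟨f₂₃, a₂₃, h₂₃⟩ := run_mark_staysSplit b₂₂ L
  replace L := L.update (a := 23) (by omega) f₂₃
  generalize Code.run _ _ s = s at a₂₃ ⊢
  obtain ⟨g₂₃, b₂₃, k₂₃⟩ := run_mark_rebranches a₂₃ L (fun p => by simpa using h₁₃ p)
    (fun p => by simpa using h₁₇ p) (fun p => by
      rw [LSTS.BifurcationEdge, LSTS.not_noBifurcation_iff]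
      simp only [Function.update_self, ne_eq, Nat.reduceEqDiff, not_false_eq_true,
        Function.update_of_ne, k₂₂, h₂₂, hz 22 (by omega), lt_irrefl, false_or]
      constructor
      · rintro (⟨h, h'⟩ | ⟨t, t', j', h, h'⟩)
        · exact ⟨h, .inl h'⟩
        · exact ⟨⟨t, h⟩, .inr ⟨t, t', j', h, h'⟩⟩
      · rintro ⟨h, h' | ⟨t, t', j', h'⟩⟩
        · exact .inl ⟨h, h'⟩
        · exact .inr ⟨t, t', j', h'⟩)
  generalize Code.run _ _ s = s at b₂₃ ⊢
  refine ⟨g₂₃ 0, by simp [Expr.eval, b₂₃], ?_⟩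
  rw [k₂₃]
  simp only [Function.update_self, ne_eq, Nat.reduceEqDiff, not_false_eq_true,
    Function.update_of_ne, h₂₃, hz 23 (by omega), lt_irrefl, false_or]
  rw [h₂₁]
  rfl

end

end RAM

theorem theorem8 :
    (∃ (P : RAM.Program) (C : ℕ),
      ∀ (X : Type u) (T : Type v) (A : Type w) (n m k : ℕ)
        (eX : X ≃ Fin n) (eT : T ≃ Fin m) (eA : A ≃ Fin k) (S : LSTS X T A),
        ∃ (steps : ℕ) (final : RAM.Store),
          RAM.Exec P (S.input eX eT eA) steps final ∧
          steps ≤ C * (n ^ 4 * m ^ 2 + 1) ∧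
          (S.EventuallyStronglyDetectable → final.reg 0 = 1) ∧
          (¬ S.EventuallyStronglyDetectable → final.reg 0 = 0)) ∧
    (∀ (X : Type u) (T : Type v) (A : Type w) [Finite X] [Finite T] [Finite A]
      (S : LSTS X T A),
      ¬ S.EventuallyStronglyDetectable ↔
        (∃ p ∈ S.cc.acc.onObservableCycle, p.1.1 ≠ p.1.2) ∨
        (S.acc.onObservableCycle ∩ S.acc.onBifurcationCycle).Nonempty) := by
  obtain ⟨C, hC⟩ := RAM.Code.exec_program RAM.degN_detector RAM.degM_detector
  refine ⟨⟨RAM.detector.program, C, fun X T A n m k eX eT eA S => ?_⟩,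
    fun X T A _ _ _ S => LSTS.not_eventuallyStronglyDetectable_iff_cycles⟩
  obtain ⟨steps, final, hexec, hsteps, hzero, hpos⟩ := hC (S.input eX eT eA) fun i => rfl
  have : Finite X := .of_equiv _ eX.symm
  refine ⟨steps, final, hexec, hsteps, ?_⟩
  replace hzero : n = 0 ∨ m = 0 → final.reg 0 = 1 := hzero
  have hcase : (n = 0 ∨ m = 0) ∨ (0 < n ∧ 0 < m) := by omega
  rcases hcase with hnm | ⟨hn, hm⟩
  -- Without states or without events there is no infinite run; this is why the program answers 1
  -- there and the time bound contains `+ 1`.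
  · have hesd : S.EventuallyStronglyDetectable := by
      rintro σ ⟨t, ⟨x, -⟩, -⟩
      rcases hnm with rfl | rfl
      · exact (eX (x 0)).elim0
      · exact (eT (t 0)).elim0
    exact ⟨fun _ => hzero hnm, fun h => absurd hesd h⟩
  · have : Nonempty T := ⟨eT.symm ⟨0, hm⟩⟩
    obtain ⟨b, hb, hiff⟩ := RAM.run_detector S eX eT eA
    have hfin : final.reg 0 = 1 - b := (hpos hn hm).trans hb
    rw [← LSTS.not_eventuallyStronglyDetectable_iff] at hiff
    refine ⟨fun h => ?_, fun h => ?_⟩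
    · have : ¬ 0 < b := fun hb => hiff.1 hb h
      omega
    · have := hiff.2 h
      omega
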